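/- Let $\Lambda$ be the real Banach algebra of supernumbers $z=\sum_I z_I\zeta^I$ ($I$ ranging over the finite increasing multi-indices of countably many anticommuting generators $\zeta^i$, $z_I\in\mathbb{R}$) with $\|z\|=\sum_I|z_I|<\infty$, and let $\Lambda=\Lambda^0\oplus\Lambda^1$ be its decomposition into even and odd elements. Let $M$ be a $G^\infty$ supermanifold of dimension $(m,n)$, i.e. a space with an atlas of charts in $\mathbb{R}^{m|n}=(\Lambda^0)^m\times(\Lambda^1)^n$ whose transition maps are $G^\infty$. For $p\in M$ let $T_pM$ be the left $\Lambda$-module of all sums of an even and an odd graded-$\Lambda$-linear graded derivation, at $p$, from the germs of $\Lambda$-valued $G^\infty$ functions to $\Lambda$. Let $g$ be a super Riemannian metric on $M$: a family of biadditive maps $g_p:T_pM\times T_pM\to\Lambda$ such that $g(X,Y)$ is $G^\infty$ on $U$ for all super vector fields $X,Y$ on an open set $U\subseteq M$, and 1. $g_p(\lambda x+\mu y,z)=\lambda g_p(x,z)+\mu g_p(y,z)$ for $\lambda,\mu\in\Lambda$; 2. $g_p(x,y)=(-1)^{|x||y|}g_p(y,x)$ for pure $x,y$; 3. $g_p$ is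 nondegenerate over $\Lambda$: $g_p(\cdot,z)=0$ if and only if $z=0$, and every left $\Lambda$-linear map $T_pM\to\Lambda$ has the form $g_p(\cdot,z)$ (equivalently, the matrix of $g_p$ in a pure basis of $T_pM$ is invertible); 4. $g$ is even: $|g_p(x,y)|=|x|+|y|$ for pure $x,y$. Then $n$ is even, and every $p\in M$ has an open neighbourhood $U$ with $G^\infty$ super vector fields $\bar e_1,\dots,\bar e_m$ (even) and $\bar f_1,\dots,\bar f_n$ (odd) on $U$ that form a pure basis of the $\Lambda$-module $T_qM$ at every $q\in U$ and relative to which the matrix of $g$ on $U$ is $$\Gamma_g=\begin{pmatrix}\eta&0\\0&\mathcal{J}\end{pmatrix},\qquad \eta=\mathrm{diag}(d_1,\dots,d_m),\qquad \mathcal{J}=\mathrm{diag}(J,\dots,J),\qquad J=\begin{pmatrix}0&1\\-1&0\end{pmatrix},$$ where the $d_i:U\to\Lambda^0$ are $G^\infty$ functions whose values are invertible elements of $\Lambda^0$. -/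

import Mathlib

open scoped Topology ENNReal
open Filter

namespace SuperGeometry

noncomputable section

/-! ## Supernumbers -/

/-- The underlying real Banach space of the algebra of (real) supernumbers: absolutely summable
families `z = ∑ z_I ζ^I` indexed by the finite sets `I = {i₁ < ⋯ < i_k}` of natural numbers, where
`ζ^I = ζ^{i₁} ⋯ ζ^{i_k}`, with the norm `‖z‖ = ∑ |z_I|`. -/
def SuperNumber : Type := lp (fun _ : Finset ℕ => ℝ) 1

namespace SuperNumber

instance : NormedAddCommGroup SuperNumber :=
  inferInstanceAs (NormedAddCommGroup (lp (fun _ : Finset ℕ => ℝ) 1))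

instance : NormedSpace ℝ SuperNumber :=
  inferInstanceAs (NormedSpace ℝ (lp (fun _ : Finset ℕ => ℝ) 1))

instance : CompleteSpace SuperNumber :=
  inferInstanceAs (CompleteSpace (lp (fun _ : Finset ℕ => ℝ) 1))

/-- The coefficient `z_I` of `ζ^I`. -/
def coeff (z : SuperNumber) (I : Finset ℕ) : ℝ :=
  (show lp (fun _ : Finset ℕ => ℝ) 1 from z).1 I

@[ext] theorem ext {a b : SuperNumber} (h : ∀ I, a.coeff I = b.coeff I) : a = b :=
  lp.ext (funext h)

@[simp] theorem coeff_add (a b : SuperNumber) (I : Finset ℕ) :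
    (a + b).coeff I = a.coeff I + b.coeff I := rfl

@[simp] theorem coeff_zero (I : Finset ℕ) : (0 : SuperNumber).coeff I = 0 := rfl

@[simp] theorem coeff_neg (a : SuperNumber) (I : Finset ℕ) : (-a).coeff I = -a.coeff I := rfl

@[simp] theorem coeff_sub (a b : SuperNumber) (I : Finset ℕ) :
    (a - b).coeff I = a.coeff I - b.coeff I := rfl

@[simp] theorem coeff_smul (c : ℝ) (a : SuperNumber) (I : Finset ℕ) :
    (c • a).coeff I = c * a.coeff I := rfl

theorem norm_def (z : SuperNumber) : ‖z‖ = ∑' I, |z.coeff I| := by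
  have h := lp.norm_eq_tsum_rpow (p := 1) (by simp) (show lp (fun _ : Finset ℕ => ℝ) 1 from z)
  simp only [ENNReal.toReal_one, Real.rpow_one, div_one] at h
  exact h

theorem summable_abs (z : SuperNumber) : Summable fun I => |z.coeff I| := by
  have h := (memℓp_gen_iff (p := 1) (by simp)).1
    (lp.memℓp (show lp (fun _ : Finset ℕ => ℝ) 1 from z))
  simp only [ENNReal.toReal_one, Real.rpow_one] at h
  exact h

/-- An absolutely summable family of coefficients as a supernumber. -/
def mk (f : Finset ℕ → ℝ) (hf : Summable fun I => |f I|) : SuperNumber :=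
  (⟨f, (memℓp_gen_iff (p := 1) (by simp)).2 (by simpa using hf)⟩ :
    lp (fun _ : Finset ℕ => ℝ) 1)

@[simp] theorem coeff_mk (f : Finset ℕ → ℝ) (hf : Summable fun I => |f I|) (I : Finset ℕ) :
    (mk f hf).coeff I = f I := rfl

/-- The sign with `ζ^A ζ^B = sgn A B • ζ^(A ∪ B)` for disjoint `A`, `B`: the parity of the number
of transpositions that bring the word `ζ^A ζ^B` into increasing order. -/
def sgn (A B : Finset ℕ) : ℝ := (-1) ^ ((A ×ˢ B).filter fun x => x.2 < x.1).card

theorem abs_sgn (A B : Finset ℕ) : |sgn A B| = 1 := by simp [sgn, abs_pow]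

theorem sgn_union_left {A B : Finset ℕ} (C : Finset ℕ) (h : Disjoint A B) :
    sgn (A ∪ B) C = sgn A C * sgn B C := by
  unfold sgn
  rw [← pow_add, Finset.union_product, Finset.filter_union, Finset.card_union_of_disjoint]
  exact Finset.disjoint_filter_filter (Finset.disjoint_product.2 (Or.inl h))

theorem sgn_union_right (A : Finset ℕ) {B C : Finset ℕ} (h : Disjoint B C) :
    sgn A (B ∪ C) = sgn A B * sgn A C := by
  unfold sgn
  rw [← pow_add, Finset.product_union, Finset.filter_union, Finset.card_union_of_disjoint]
  exact Finset.disjoint_filter_filter (Finset.disjoint_product.2 (Or.inr h))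

theorem sgn_swap {A B : Finset ℕ} (h : Disjoint A B) :
    sgn B A = (-1) ^ (A.card * B.card) * sgn A B := by
  have h1 : ((B ×ˢ A).filter fun x => x.2 < x.1).card
      = ((A ×ˢ B).filter fun x => ¬ x.2 < x.1).card := by
    refine Finset.card_bij' (fun x _ => (x.2, x.1)) (fun x _ => (x.2, x.1)) ?_ ?_ ?_ ?_
    · rintro ⟨x, y⟩ hx
      simp only [Finset.mem_filter, Finset.mem_product] at hx ⊢
      exact ⟨⟨hx.1.2, hx.1.1⟩, by omega⟩
    · rintro ⟨x, y⟩ hx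
      simp only [Finset.mem_filter, Finset.mem_product] at hx ⊢
      have : x ≠ y := fun e => Finset.disjoint_left.1 h hx.1.1 (e ▸ hx.1.2)
      exact ⟨⟨hx.1.2, hx.1.1⟩, by omega⟩
    · intros; rfl
    · intros; rfl
  have h2 := Finset.card_filter_add_card_filter_not (s := A ×ˢ B) (fun x => x.2 < x.1)
  unfold sgn
  rw [h1, ← Finset.card_product, ← h2, pow_add, mul_right_comm, ← mul_pow]
  simp

/-- The coefficients of a product. -/
def mulCoeff (a b : SuperNumber) (I : Finset ℕ) : ℝ :=
  ∑ A ∈ I.powerset, sgn A (I \ A) * a.coeff A * b.coeff (I \ A)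

theorem split_injective : Function.Injective
    (fun x : Σ I : Finset ℕ, {A // A ∈ I.powerset} => ((x.2 : Finset ℕ), x.1 \ (x.2 : Finset ℕ))) := by
  rintro ⟨I, A, hA⟩ ⟨J, B, hB⟩ h
  simp only [Prod.mk.injEq] at h
  obtain ⟨rfl, h2⟩ := h
  have : I = J := by
    rw [← Finset.union_sdiff_of_subset (Finset.mem_powerset.1 hA), h2,
      Finset.union_sdiff_of_subset (Finset.mem_powerset.1 hB)]
  subst this
  rfl

theorem mulCoeff_bound (a b : SuperNumber) :
    Summable (fun I => |mulCoeff a b I|) ∧ ∑' I, |mulCoeff a b I| ≤ ‖a‖ * ‖b‖ := by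
  have hprod : Summable fun x : Finset ℕ × Finset ℕ => |a.coeff x.1| * |b.coeff x.2| :=
    a.summable_abs.mul_of_nonneg b.summable_abs (fun _ => abs_nonneg _) (fun _ => abs_nonneg _)
  have hsig := hprod.comp_injective split_injective
  have hfib := hsig.sigma
  have hle : ∀ I, |mulCoeff a b I| ≤ ∑' A : {A // A ∈ I.powerset},
      |a.coeff A| * |b.coeff (I \ (A : Finset ℕ))| := by
    intro I
    rw [tsum_fintype, Finset.sum_coe_sort I.powerset (fun A => |a.coeff A| * |b.coeff (I \ A)|)]
    refine (Finset.abs_sum_le_sum_abs _ _).trans (le_of_eq (Finset.sum_congr rfl ?_))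
    intro A _
    rw [abs_mul, abs_mul, abs_sgn, one_mul]
  have hs : Summable (fun I => |mulCoeff a b I|) :=
    Summable.of_nonneg_of_le (fun _ => abs_nonneg _) hle hfib
  refine ⟨hs, (hs.tsum_le_tsum hle hfib).trans ?_⟩
  have h1 := hsig.tsum_sigma
  simp only [Function.comp_apply] at h1
  rw [← h1, norm_def, norm_def, a.summable_abs.tsum_mul_tsum b.summable_abs hprod]
  exact tsum_comp_le_tsum_of_inj hprod (fun _ => by positivity) split_injective

instance : Mul SuperNumber := ⟨fun a b => mk (mulCoeff a b) (mulCoeff_bound a b).1⟩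

instance : One SuperNumber :=
  ⟨mk (fun I => if I = ∅ then 1 else 0)
    (summable_of_ne_finset_zero (s := {∅}) (by intro I hI; simp_all))⟩

theorem coeff_mul (a b : SuperNumber) (I : Finset ℕ) :
    (a * b).coeff I = ∑ A ∈ I.powerset, sgn A (I \ A) * a.coeff A * b.coeff (I \ A) := rfl

theorem coeff_one (I : Finset ℕ) : (1 : SuperNumber).coeff I = if I = ∅ then 1 else 0 := rfl

theorem mul_assoc' (a b c : SuperNumber) : a * b * c = a * (b * c) := by
  ext I
  simp only [coeff_mul, Finset.mul_sum, Finset.sum_mul]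
  rw [Finset.sum_sigma', Finset.sum_sigma']
  refine Finset.sum_bij' (fun x _ => ⟨x.2, x.1 \ x.2⟩) (fun x _ => ⟨x.1 ∪ x.2, x.1⟩) ?_ ?_ ?_ ?_ ?_
  · rintro ⟨D, A⟩ h
    simp only [Finset.mem_sigma, Finset.mem_powerset] at h ⊢
    exact ⟨h.2.trans h.1, Finset.sdiff_subset_sdiff h.1 le_rfl⟩
  · rintro ⟨A, B⟩ h
    simp only [Finset.mem_sigma, Finset.mem_powerset] at h ⊢
    exact ⟨Finset.union_subset h.1 (h.2.trans Finset.sdiff_subset), Finset.subset_union_left⟩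
  · rintro ⟨D, A⟩ h
    simp only [Finset.mem_sigma, Finset.mem_powerset] at h
    simp [Finset.union_sdiff_of_subset h.2]
  · rintro ⟨A, B⟩ h
    simp only [Finset.mem_sigma, Finset.mem_powerset] at h
    have : Disjoint B A := Finset.disjoint_left.2 fun x hx => (Finset.mem_sdiff.1 (h.2 hx)).2
    simp [Finset.union_sdiff_cancel_left this.symm]
  · rintro ⟨D, A⟩ h
    simp only [Finset.mem_sigma, Finset.mem_powerset] at h
    obtain ⟨hD, hA⟩ := h
    have e1 : (I \ A) \ (D \ A) = I \ D := by
      ext x; simp only [Finset.mem_sdiff]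
      constructor
      · rintro ⟨⟨h1, h2⟩, h3⟩; exact ⟨h1, fun h4 => h3 ⟨h4, h2⟩⟩
      · rintro ⟨h1, h2⟩; exact ⟨⟨h1, fun h3 => h2 (hA h3)⟩, fun h3 => h2 h3.1⟩
    have d1 : Disjoint A (D \ A) := Finset.disjoint_sdiff
    have d2 : Disjoint (D \ A) (I \ D) :=
      Finset.disjoint_left.2 fun x hx hx' =>
        (Finset.mem_sdiff.1 hx').2 (Finset.mem_sdiff.1 hx).1
    have e2 : sgn D (I \ D) = sgn A (I \ D) * sgn (D \ A) (I \ D) := by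
      rw [← sgn_union_left _ d1, Finset.union_sdiff_of_subset hA]
    have e3 : sgn A (I \ A) = sgn A (D \ A) * sgn A (I \ D) := by
      rw [← sgn_union_right _ d2]
      congr 1
      ext x; simp only [Finset.mem_sdiff, Finset.mem_union]
      constructor
      · rintro ⟨h1, h2⟩
        by_cases h3 : x ∈ D
        · exact Or.inl ⟨h3, h2⟩
        · exact Or.inr ⟨h1, h3⟩
      · rintro (⟨h1, h2⟩ | ⟨h1, h2⟩)
        · exact ⟨hD h1, h2⟩
        · exact ⟨h1, fun h3 => h2 (hA h3)⟩
    simp only [e1]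
    rw [e2, e3]
    ring

theorem one_mul' (a : SuperNumber) : 1 * a = a := by
  ext I
  rw [coeff_mul, Finset.sum_eq_single ∅]
  · simp [coeff_one, sgn]
  · intro A _ hA; simp [coeff_one, hA]
  · intro h; simp at h

theorem mul_one' (a : SuperNumber) : a * 1 = a := by
  ext I
  rw [coeff_mul, Finset.sum_eq_single I]
  · simp [coeff_one, sgn]
  · intro A hA hne
    have : I \ A ≠ ∅ := fun h =>
      hne (Finset.Subset.antisymm (Finset.mem_powerset.1 hA) (Finset.sdiff_eq_empty_iff_subset.1 h))
    simp [coeff_one, this]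
  · intro h; simp at h

/-- The supernumbers form a real Banach algebra. -/
instance : NormedRing SuperNumber :=
  { (inferInstance : NormedAddCommGroup SuperNumber) with
    mul := (· * ·)
    one := 1
    mul_assoc := mul_assoc'
    one_mul := one_mul'
    mul_one := mul_one'
    left_distrib := fun a b c => by
      ext I; simp only [coeff_mul, coeff_add, mul_add, Finset.sum_add_distrib]
    right_distrib := fun a b c => by
      ext I; simp only [coeff_mul, coeff_add, mul_add, add_mul, Finset.sum_add_distrib]
    zero_mul := fun a => by ext I; simp [coeff_mul]
    mul_zero := fun a => by ext I; simp [coeff_mul]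
    norm_mul_le := fun a b => by
      rw [norm_def (a * b)]
      exact (mulCoeff_bound a b).2 }

instance : NormedAlgebra ℝ SuperNumber :=
  { Algebra.ofModule
      (fun r a b => by
        ext I; simp only [coeff_mul, coeff_smul, Finset.mul_sum]
        exact Finset.sum_congr rfl fun _ _ => by ring)
      (fun r a b => by
        ext I; simp only [coeff_mul, coeff_smul, Finset.mul_sum]
        exact Finset.sum_congr rfl fun _ _ => by ring) with
    norm_smul_le := fun r a => norm_smul_le r a }

/-- The homogeneous part `Λ^a`: `Λ^0` consists of the even and `Λ^1` of the odd supernumbers. -/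
def part (a : ZMod 2) : Submodule ℝ SuperNumber where
  carrier := {z | ∀ I : Finset ℕ, (I.card : ZMod 2) ≠ a → z.coeff I = 0}
  add_mem' := fun ha hb I hI => by rw [coeff_add, ha I hI, hb I hI, add_zero]
  zero_mem' := fun _ _ => rfl
  smul_mem' := fun c z hz I hI => by rw [coeff_smul, hz I hI, mul_zero]

theorem mem_part {a : ZMod 2} {z : SuperNumber} :
    z ∈ part a ↔ ∀ I : Finset ℕ, (I.card : ZMod 2) ≠ a → z.coeff I = 0 := Iff.rfl

/-- The grading involution: the identity on `Λ^0` and minus the identity on `Λ^1`. -/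
def invol : SuperNumber →L[ℝ] SuperNumber :=
  LinearMap.mkContinuous
    { toFun := fun z => mk (fun I => (-1) ^ I.card * z.coeff I)
        (by simpa [abs_mul, abs_pow] using z.summable_abs)
      map_add' := fun a b => by ext I; simp [mul_add]
      map_smul' := fun c a => by ext I; simp only [coeff_mk, coeff_smul, RingHom.id_apply]; ring }
    1 (fun z => by
      rw [norm_def, norm_def, one_mul]
      simp [abs_mul, abs_pow])

theorem coeff_invol (z : SuperNumber) (I : Finset ℕ) :
    (invol z).coeff I = (-1) ^ I.card * z.coeff I := rfl

theorem mul_comm_even (z : SuperNumber) {h : SuperNumber} (hh : h ∈ part 0) : z * h = h * z := by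
  ext I
  rw [coeff_mul, coeff_mul]
  refine Finset.sum_bij' (fun A _ => I \ A) (fun A _ => I \ A) ?_ ?_ ?_ ?_ ?_
  · intro A _; simp
  · intro A _; simp
  · intro A hA; exact Finset.sdiff_sdiff_eq_self (Finset.mem_powerset.1 hA)
  · intro A hA; exact Finset.sdiff_sdiff_eq_self (Finset.mem_powerset.1 hA)
  · intro A hA
    rw [Finset.sdiff_sdiff_eq_self (Finset.mem_powerset.1 hA)]
    by_cases hp : ((I \ A).card : ZMod 2) = 0
    · rw [sgn_swap (A := A) (B := I \ A) Finset.disjoint_sdiff]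
      have he : Even (I \ A).card := (ZMod.natCast_eq_zero_iff_even).1 hp
      rw [(he.mul_left _).neg_one_pow]
      ring
    · rw [mem_part.1 hh _ hp]; ring

theorem mul_comm_odd (z : SuperNumber) {h : SuperNumber} (hh : h ∈ part 1) :
    z * h = h * invol z := by
  ext I
  rw [coeff_mul, coeff_mul]
  refine Finset.sum_bij' (fun A _ => I \ A) (fun A _ => I \ A) ?_ ?_ ?_ ?_ ?_
  · intro A _; simp
  · intro A _; simp
  · intro A hA; exact Finset.sdiff_sdiff_eq_self (Finset.mem_powerset.1 hA)
  · intro A hA; exact Finset.sdiff_sdiff_eq_self (Finset.mem_powerset.1 hA)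
  · intro A hA
    rw [Finset.sdiff_sdiff_eq_self (Finset.mem_powerset.1 hA), coeff_invol]
    by_cases hp : ((I \ A).card : ZMod 2) = 1
    · rw [sgn_swap (A := A) (B := I \ A) Finset.disjoint_sdiff]
      have he : Odd (I \ A).card := (ZMod.natCast_eq_one_iff_odd).1 hp
      rw [mul_comm A.card, pow_mul, he.neg_one_pow]
      have h2 : ((-1 : ℝ) ^ A.card) * (-1) ^ A.card = 1 := by rw [← mul_pow]; simp
      linear_combination (-(sgn A (I \ A) * z.coeff A * h.coeff (I \ A))) * h2
    · rw [mem_part.1 hh _ hp]; ring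

end SuperNumber

open SuperNumber

/-- The sign `(-1)^{ab}` of the rule of signs. -/
def koszul (a b : ZMod 2) : ℝ := if a = 1 ∧ b = 1 then -1 else 1

/-! ## Superspace and `G^∞` functions -/

/-- Parity of the `k`-th coordinate of `ℝ^{m|n}`: `m` even coordinates, `n` odd ones. -/
def parity {m n : ℕ} : Fin m ⊕ Fin n → ZMod 2 := Sum.elim (fun _ => 0) (fun _ => 1)

/-- The superspace `ℝ^{m|n} = (Λ^0)^m × (Λ^1)^n` with the norm `∑ ‖x^i‖ + ∑ ‖θ^α‖`. -/
abbrev SuperSpace (m n : ℕ) : Type :=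
  PiLp 1 (fun k : Fin m ⊕ Fin n => part (parity k))

variable {m n : ℕ}

/-- `f` is superdifferentiable at `x` with partial derivatives `f' k`:
`f (x + h) = f x + ∑ h^k * f' k + o(‖h‖)`. -/
def HasSuperDerivAt (f : SuperSpace m n → SuperNumber) (f' : Fin m ⊕ Fin n → SuperNumber)
    (x : SuperSpace m n) : Prop :=
  ∃ L : SuperSpace m n →L[ℝ] SuperNumber,
    (∀ h, L h = ∑ k, (h k : SuperNumber) * f' k) ∧ HasFDerivAt f L x

/-- `f` is of class `G^r` on the open set `U`. -/
def IsG : ℕ → (SuperSpace m n → SuperNumber) → Set (SuperSpace m n) → Prop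
  | 0, f, U => ContinuousOn f U
  | r + 1, f, U => ∃ f' : Fin m ⊕ Fin n → SuperSpace m n → SuperNumber,
      (∀ k, IsG r (f' k) U) ∧ ∀ x ∈ U, HasSuperDerivAt f (fun k => f' k x) x

/-- `f` is of class `G^∞` (supersmooth) on the open set `U`. -/
def IsGInfty (f : SuperSpace m n → SuperNumber) (U : Set (SuperSpace m n)) : Prop :=
  ∀ r, IsG r f U

theorem IsG.mono {U V : Set (SuperSpace m n)} (hVU : V ⊆ U) :
    ∀ {r : ℕ} {f : SuperSpace m n → SuperNumber}, IsG r f U → IsG r f V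
  | 0, _, h => ContinuousOn.mono h hVU
  | _ + 1, _, ⟨f', h1, h2⟩ => ⟨f', fun k => (h1 k).mono hVU, fun x hx => h2 x (hVU hx)⟩

theorem IsG.of_succ {U : Set (SuperSpace m n)} :
    ∀ {r : ℕ} {f : SuperSpace m n → SuperNumber}, IsG (r + 1) f U → IsG r f U
  | 0, _, ⟨_, _, h2⟩ => fun x hx => by
      obtain ⟨L, _, hL⟩ := h2 x hx
      exact hL.continuousAt.continuousWithinAt
  | _ + 1, _, ⟨f', h1, h2⟩ => ⟨f', fun k => (h1 k).of_succ, h2⟩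

theorem isG_const (c : SuperNumber) (U : Set (SuperSpace m n)) :
    ∀ r : ℕ, IsG r (fun _ => c) U := by
  intro r
  induction r generalizing c with
  | zero => exact continuousOn_const
  | succ r ih =>
    exact ⟨fun _ _ => 0, fun _ => ih 0, fun x _ => ⟨0, by simp, hasFDerivAt_const c x⟩⟩

theorem IsG.add {U : Set (SuperSpace m n)} :
    ∀ {r : ℕ} {f g : SuperSpace m n → SuperNumber}, IsG r f U → IsG r g U →
      IsG r (fun x => f x + g x) U
  | 0, _, _, hf, hg => ContinuousOn.add hf hg
  | _ + 1, _, _, ⟨f', hf1, hf2⟩, ⟨g', hg1, hg2⟩ =>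
    ⟨fun k x => f' k x + g' k x, fun k => (hf1 k).add (hg1 k), fun x hx => by
      obtain ⟨L, hL, hL'⟩ := hf2 x hx
      obtain ⟨N, hN, hN'⟩ := hg2 x hx
      exact ⟨L + N, fun h => by simp [hL, hN, mul_add, Finset.sum_add_distrib], hL'.add hN'⟩⟩

theorem isG_const_smul {U : Set (SuperSpace m n)} (c : ℝ) :
    ∀ {r : ℕ} {f : SuperSpace m n → SuperNumber}, IsG r f U → IsG r (fun x => c • f x) U
  | 0, _, hf => ContinuousOn.const_smul hf c
  | _ + 1, _, ⟨f', hf1, hf2⟩ =>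
    ⟨fun k x => c • f' k x, fun k => isG_const_smul c (hf1 k), fun x hx => by
      obtain ⟨L, hL, hL'⟩ := hf2 x hx
      exact ⟨c • L, fun h => by simp [hL, Finset.smul_sum], hL'.const_smul c⟩⟩

theorem invol_mul_of_mem {a : ZMod 2} {h : SuperNumber} (hh : h ∈ part a) (z : SuperNumber) :
    invol (h * z) = h * (koszul a 1 • invol z) := by
  ext I
  rw [coeff_invol, coeff_mul, coeff_mul, Finset.mul_sum]
  refine Finset.sum_congr rfl fun A hA => ?_
  rw [coeff_smul, coeff_invol]
  by_cases hp : (A.card : ZMod 2) = a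
  · have hc : I.card = A.card + (I \ A).card := by
      rw [Finset.card_sdiff_of_subset (Finset.mem_powerset.1 hA)]
      have := Finset.card_le_card (Finset.mem_powerset.1 hA)
      omega
    have hs : ((-1 : ℝ) ^ A.card) = koszul a 1 := by
      unfold koszul
      rcases Nat.even_or_odd A.card with he | ho
      · have : a = 0 := hp ▸ (ZMod.natCast_eq_zero_iff_even).2 he
        rw [he.neg_one_pow, this]; simp
      · have : a = 1 := hp ▸ (ZMod.natCast_eq_one_iff_odd).2 ho
        rw [ho.neg_one_pow, this]; simp
    rw [hc, pow_add, hs]; ring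
  · rw [mem_part.1 hh _ hp]; ring

theorem IsG.invol {U : Set (SuperSpace m n)} :
    ∀ {r : ℕ} {f : SuperSpace m n → SuperNumber}, IsG r f U → IsG r (fun x => invol (f x)) U
  | 0, _, hf => SuperNumber.invol.continuous.comp_continuousOn hf
  | _ + 1, _, ⟨f', hf1, hf2⟩ =>
    ⟨fun k x => koszul (parity k) 1 • SuperNumber.invol (f' k x),
      fun k => isG_const_smul _ (hf1 k).invol, fun x hx => by
        obtain ⟨L, hL, hL'⟩ := hf2 x hx
        refine ⟨SuperNumber.invol.comp L, fun h => ?_, SuperNumber.invol.hasFDerivAt.comp x hL'⟩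
        rw [ContinuousLinearMap.comp_apply, hL, map_sum]
        exact Finset.sum_congr rfl fun k _ => invol_mul_of_mem (h k).2 _⟩

theorem IsG.mul {U : Set (SuperSpace m n)} {r : ℕ} {f g : SuperSpace m n → SuperNumber}
    (hf : IsG r f U) (hg : IsG r g U) : IsG r (fun x => f x * g x) U := by
  induction r generalizing f g with
  | zero => exact ContinuousOn.mul hf hg
  | succ r ih =>
    have hf0 := hf.of_succ
    have hg0 := hg.of_succ
    obtain ⟨f', hf1, hf2⟩ := hf
    obtain ⟨g', hg1, hg2⟩ := hg
    refine ⟨fun k x => f' k x * g x +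
      (if parity k = 0 then f x else SuperNumber.invol (f x)) * g' k x, fun k => ?_, fun x hx => ?_⟩
    · refine (ih (hf1 k) hg0).add (ih ?_ (hg1 k))
      split_ifs
      · exact hf0
      · exact hf0.invol
    · obtain ⟨L, hL, hL'⟩ := hf2 x hx
      obtain ⟨N, hN, hN'⟩ := hg2 x hx
      refine ⟨_, fun h => ?_, hL'.mul' hN'⟩
      simp only [_root_.add_apply, _root_.smul_apply,
        MulOpposite.smul_eq_mul_unop, MulOpposite.unop_op, hL, hN, smul_eq_mul, Finset.sum_mul,
        Finset.mul_sum, mul_add, Finset.sum_add_distrib]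
      rw [add_comm]
      congr 1
      · simp only [mul_assoc]
      · refine Finset.sum_congr rfl fun k _ => ?_
        rw [← mul_assoc, ← mul_assoc]
        congr 1
        rcases k with i | j
        · simpa [parity] using mul_comm_even (f x) (h (Sum.inl i)).2
        · simpa [parity] using mul_comm_odd (f x) (h (Sum.inr j)).2

/-! ## Supermanifolds -/

/-- `M` with its atlas of charts in `ℝ^{m|n}` is a `G^∞` supermanifold of dimension `(m, n)`: the
components of all transition maps are of class `G^∞`. -/
class IsSuperManifold (m n : ℕ) (M : Type*) [TopologicalSpace M]
    [ChartedSpace (SuperSpace m n) M] : Prop where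
  compatible : ∀ e ∈ atlas (SuperSpace m n) M, ∀ e' ∈ atlas (SuperSpace m n) M,
    ∀ k, IsGInfty (fun x => ((e' (e.symm x)) k : SuperNumber)) (e.symm.trans e').source

section Manifold

variable (m n) {M : Type*} [TopologicalSpace M] [ChartedSpace (SuperSpace m n) M]

/-- `f` is of class `G^∞` on the open subset `U` of `M`. -/
def IsGInftyOn (f : M → SuperNumber) (U : Set M) : Prop :=
  ∀ e ∈ atlas (SuperSpace m n) M, IsGInfty (fun x => f (e.symm x)) (e.target ∩ e.symm ⁻¹' U)

/-- `f` is of class `G^∞` on a neighbourhood of `p`. -/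
def IsGInftyAt (f : M → SuperNumber) (p : M) : Prop :=
  ∃ U : Set M, IsOpen U ∧ p ∈ U ∧ IsGInftyOn m n f U

variable {m n} in
theorem IsGInftyAt.map₂ {f g : M → SuperNumber} {p : M} (op : SuperNumber → SuperNumber → SuperNumber)
    (hop : ∀ (V : Set (SuperSpace m n)) (F G : SuperSpace m n → SuperNumber) (r : ℕ),
      IsG r F V → IsG r G V → IsG r (fun x => op (F x) (G x)) V)
    (hf : IsGInftyAt m n f p) (hg : IsGInftyAt m n g p) :
    IsGInftyAt m n (fun q => op (f q) (g q)) p := by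
  obtain ⟨U, hU, hpU, hfU⟩ := hf
  obtain ⟨V, hV, hpV, hgV⟩ := hg
  refine ⟨U ∩ V, hU.inter hV, ⟨hpU, hpV⟩, fun e he r => hop _ _ _ r ?_ ?_⟩
  · exact (hfU e he r).mono (Set.inter_subset_inter_right _ fun x hx => hx.1)
  · exact (hgV e he r).mono (Set.inter_subset_inter_right _ fun x hx => hx.2)

theorem isGInftyAt_const (c : SuperNumber) (p : M) : IsGInftyAt m n (fun _ => c) p :=
  ⟨Set.univ, isOpen_univ, trivial, fun _ _ r => isG_const c _ r⟩

/-- The ring of germs at `p` of `G^∞` functions. -/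
def SmoothGerm (p : M) : Subring (Germ (𝓝 p) SuperNumber) where
  carrier := {F | ∃ f : M → SuperNumber, IsGInftyAt m n f p ∧ (f : Germ (𝓝 p) SuperNumber) = F}
  mul_mem' := by
    rintro _ _ ⟨f, hf, rfl⟩ ⟨g, hg, rfl⟩
    exact ⟨_, hf.map₂ (· * ·) (fun _ _ _ _ h1 h2 => h1.mul h2) hg, rfl⟩
  one_mem' := ⟨_, isGInftyAt_const m n 1 p, rfl⟩
  add_mem' := by
    rintro _ _ ⟨f, hf, rfl⟩ ⟨g, hg, rfl⟩
    exact ⟨_, hf.map₂ (· + ·) (fun _ _ _ _ h1 h2 => h1.add h2) hg, rfl⟩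
  zero_mem' := ⟨_, isGInftyAt_const m n 0 p, rfl⟩
  neg_mem' := by
    rintro _ ⟨f, hf, rfl⟩
    refine ⟨_, (isGInftyAt_const m n (-1) p).map₂ (· * ·) (fun _ _ _ _ h1 h2 => h1.mul h2) hf, ?_⟩
    exact congrArg _ (funext fun x => neg_one_mul (f x))

/-- The germ of a constant function. -/
def constGerm (p : M) (c : SuperNumber) : SmoothGerm m n p :=
  ⟨((fun _ => c : M → SuperNumber) : Germ (𝓝 p) SuperNumber), _, isGInftyAt_const m n c p, rfl⟩

/-- `X` is a homogeneous tangent vector of parity `a` at `p`: a graded derivation of parity `a`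
from the germs of `G^∞` functions at `p` to the supernumbers, graded linear over the
supernumbers. -/
structure IsHomogeneousVector (p : M) (a : ZMod 2) (X : SmoothGerm m n p → SuperNumber) : Prop where
  map_add : ∀ F G : SmoothGerm m n p, X (F + G) = X F + X G
  map_const_mul : ∀ (b : ZMod 2), ∀ c ∈ part b, ∀ F : SmoothGerm m n p,
    X (constGerm m n p c * F) = koszul a b • (c * X F)
  leibniz : ∀ (b : ZMod 2) (F G : SmoothGerm m n p), (F : Germ (𝓝 p) SuperNumber).LiftPred (· ∈ part b) →
    X (F * G) = X F * (G : Germ (𝓝 p) SuperNumber).value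
      + koszul a b • ((F : Germ (𝓝 p) SuperNumber).value * X G)
  map_parity : ∀ (b : ZMod 2) (F : SmoothGerm m n p), (F : Germ (𝓝 p) SuperNumber).LiftPred (· ∈ part b) →
    X F ∈ part (a + b)

/-- The tangent space `T_pM`: the left module over the supernumbers consisting of the sums of an
even and an odd graded derivation (these sums are closed under left multiplication by
supernumbers), acting by `(c • X) F = c * X F`. -/
def SuperTangent (p : M) : Submodule SuperNumber (SmoothGerm m n p → SuperNumber) :=
  Submodule.span SuperNumber {X | ∃ a, IsHomogeneousVector m n p a X}

variable {m n} in
/-- A tangent vector is pure of parity `a`. -/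
def IsPure {p : M} (a : ZMod 2) (X : SuperTangent m n p) : Prop :=
  IsHomogeneousVector m n p a (X : SmoothGerm m n p → SuperNumber)

open Classical in
variable {m n} in
/-- The value `X f` for a function `f` of class `G^∞` near `p` (and `0` for other functions). -/
def applyFun {p : M} (X : SuperTangent m n p) (f : M → SuperNumber) : SuperNumber :=
  if h : IsGInftyAt m n f p then
    (X : SmoothGerm m n p → SuperNumber) ⟨(f : Germ (𝓝 p) SuperNumber), f, h, rfl⟩
  else 0

variable {m n} in
/-- `X` is a super vector field on the open set `U` (its values outside `U` are irrelevant): it maps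
`G^∞` functions to `G^∞` functions. -/
def IsVectorFieldOn (X : ∀ p : M, SuperTangent m n p) (U : Set M) : Prop :=
  ∀ V ⊆ U, IsOpen V → ∀ f : M → SuperNumber, IsGInftyOn m n f V →
    IsGInftyOn m n (fun q => applyFun (X q) f) V

variable (M) in
/-- An (even) super Riemannian metric on `M`. -/
structure SuperRiemannianMetric where
  /-- The value `g_p(x, y)`. -/
  val : ∀ p : M, SuperTangent m n p → SuperTangent m n p → SuperNumber
  smooth : ∀ U : Set M, IsOpen U → ∀ X Y : ∀ p : M, SuperTangent m n p,
    IsVectorFieldOn X U → IsVectorFieldOn Y U →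
      IsGInftyOn m n (fun q => val q (X q) (Y q)) U
  linear_left : ∀ p (c d : SuperNumber) (x y z : SuperTangent m n p),
    val p (c • x + d • y) z = c * val p x z + d * val p y z
  add_right : ∀ p (x y z : SuperTangent m n p), val p x (y + z) = val p x y + val p x z
  symm : ∀ p (a b : ZMod 2) (x y : SuperTangent m n p), IsPure a x → IsPure b y →
    val p x y = koszul a b • val p y x
  even : ∀ p (a b : ZMod 2) (x y : SuperTangent m n p), IsPure a x → IsPure b y →
    val p x y ∈ part (a + b)
  nondegenerate : ∀ p (z : SuperTangent m n p), (∀ x, val p x z = 0) ↔ z = 0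
  /-- Nondegeneracy over the ring of supernumbers: `z ↦ g_p(·, z)` is onto the dual module. -/
  perfect : ∀ p (φ : SuperTangent m n p →ₗ[SuperNumber] SuperNumber),
    ∃ z : SuperTangent m n p, ∀ x, val p x z = φ x

end Manifold

/-- The block diagonal matrix of size `n` (meant for even `n`) with the blocks `(0, 1; -1, 0)`. -/
def blockJ (n : ℕ) : Matrix (Fin n) (Fin n) SuperNumber := Matrix.of fun α β =>
  if Even (α : ℕ) ∧ (β : ℕ) = α + 1 then 1
  else if Even (β : ℕ) ∧ (α : ℕ) = β + 1 then -1 else 0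

end

end SuperGeometry

namespace SuperGeometry

noncomputable section

open SuperNumber

/-! Everything is controlled by the body `z ↦ z_∅`, a continuous ring homomorphism from the
supernumbers to the reals that kills odd elements. An even supernumber with nonzero body is
invertible in the even part (`exists_even_inverse`), and nonvanishing of the body is an open
condition. A Gram-Schmidt process near `p` therefore only needs pivots whose body at `p` is nonzero,
and these come from real linear algebra.

The starting frame consists of the coordinate fields. They span each tangent module because
Hadamard's lemma (`IsGInfty.hadamard`) expands every germ to first order, and a derivation sees only
the linear terms (`tangent_eq_sum`). Since `g` identifies the tangent module with its dual, the body
of their Gram matrix at `p` is invertible (`det_bodyGram_coordField`). Evenness of `g` makes the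
mixed entries odd, so this real matrix is block diagonal: a symmetric even block and an
antisymmetric odd block, each with nonzero determinant.

On even fields, polarization produces a vector whose square has nonzero body. It is split off
orthogonally, and the Schur complement still has nonzero determinant (`exists_even_orthogonal`).
Only inverses are taken, no square roots, so the `d_i` remain arbitrary invertible even functions.
The odd fields are then made orthogonal to the even ones; the correction coefficients are odd, so
the body of the odd Gram matrix does not change (`exists_odd_orthogonal_to_even`).

On odd fields `g` is alternating, so hyperbolic pairs are split off two vectors at a time
(`exists_odd_symplectic`). A single leftover odd field would have Gram matrix zero, which forces `n`
to be even. Each step preserves the span of the frame, and linear independence follows at the end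
from the normal form itself. -/

/-! ### The sign rule. -/

theorem zmod_two_cases : ∀ a : ZMod 2, a = 0 ∨ a = 1 := by decide

@[simp] theorem koszul_zero_left (a : ZMod 2) : koszul 0 a = 1 := by simp [koszul]

@[simp] theorem koszul_zero_right (a : ZMod 2) : koszul a 0 = 1 := by simp [koszul]

@[simp] theorem koszul_one_one : koszul 1 1 = -1 := by simp [koszul]

theorem koszul_comm (a b : ZMod 2) : koszul a b = koszul b a := by
  simp only [koszul, and_comm]

theorem koszul_add_left (a b c : ZMod 2) : koszul (a + b) c = koszul a c * koszul b c := by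
  have h : (1 + 1 : ZMod 2) = 0 := by decide
  rcases zmod_two_cases a with rfl | rfl <;> rcases zmod_two_cases b with rfl | rfl <;>
    rcases zmod_two_cases c with rfl | rfl <;> simp [h]

theorem koszul_add_right (a b c : ZMod 2) : koszul a (b + c) = koszul a b * koszul a c := by
  rw [koszul_comm, koszul_add_left, koszul_comm b, koszul_comm c]

theorem koszul_mul_self (a b : ZMod 2) : koszul a b * koszul a b = 1 := by
  rcases zmod_two_cases a with rfl | rfl <;> rcases zmod_two_cases b with rfl | rfl <;> simp

/-! ### Body, homogeneous parts and invertibility of supernumbers. -/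

namespace SuperNumber

/-- The coefficient of `ζ^I` as a continuous linear functional. -/
def coeffCLM (I : Finset ℕ) : SuperNumber →L[ℝ] ℝ :=
  LinearMap.mkContinuous
    { toFun := fun z => z.coeff I
      map_add' := fun _ _ => rfl
      map_smul' := fun _ _ => rfl }
    1 (fun z => by
      rw [norm_def, one_mul]
      exact z.summable_abs.le_tsum I (fun _ _ => abs_nonneg _))

@[simp] theorem coeffCLM_apply (I : Finset ℕ) (z : SuperNumber) : coeffCLM I z = z.coeff I := rfl

/-- The body `z_∅` of a supernumber. -/
def body : SuperNumber →+* ℝ where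
  toFun z := z.coeff ∅
  map_one' := by simp [coeff_one]
  map_mul' a b := by simp [coeff_mul, sgn]
  map_zero' := rfl
  map_add' _ _ := rfl

theorem body_apply (z : SuperNumber) : body z = z.coeff ∅ := rfl

theorem continuous_body : Continuous body := (coeffCLM ∅).continuous

@[simp] theorem body_smul (c : ℝ) (z : SuperNumber) : body (c • z) = c * body z := rfl

theorem body_of_odd {z : SuperNumber} (hz : z ∈ part 1) : body z = 0 :=
  hz ∅ (by simp)

theorem one_mem_part : (1 : SuperNumber) ∈ part 0 := fun I hI => by
  rw [coeff_one, if_neg]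
  rintro rfl
  simp at hI

theorem isClosed_part (a : ZMod 2) : IsClosed (part a : Set SuperNumber) := by
  have : (part a : Set SuperNumber)
      = ⋂ (I : Finset ℕ) (_ : (I.card : ZMod 2) ≠ a), (coeffCLM I) ⁻¹' {0} := by
    ext z
    simp [mem_part]
  rw [this]
  exact isClosed_iInter fun I => isClosed_iInter fun _ =>
    isClosed_singleton.preimage (coeffCLM I).continuous

theorem mul_mem_part {a b : ZMod 2} {x y : SuperNumber} (hx : x ∈ part a) (hy : y ∈ part b) :
    x * y ∈ part (a + b) := fun I hI => by
  rw [coeff_mul]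
  refine Finset.sum_eq_zero fun A hA => ?_
  by_cases h1 : (A.card : ZMod 2) = a
  · by_cases h2 : ((I \ A).card : ZMod 2) = b
    · refine absurd ?_ hI
      rw [← h1, ← h2, ← Nat.cast_add, add_comm,
        Finset.card_sdiff_add_card_eq_card (Finset.mem_powerset.1 hA)]
    · rw [hy _ h2, mul_zero]
  · rw [hx _ h1, mul_zero, zero_mul]

theorem invol_of_mem {a : ZMod 2} {z : SuperNumber} (hz : z ∈ part a) :
    invol z = koszul a 1 • z := by
  have h := invol_mul_of_mem hz 1
  rw [mul_one] at h
  rw [h]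
  have : invol (1 : SuperNumber) = 1 := by
    ext I
    rw [coeff_invol, coeff_one]
    split_ifs with hI <;> simp [hI]
  rw [this, mul_smul_comm, mul_one]

theorem mul_comm_of_mem {a b : ZMod 2} {x y : SuperNumber} (hx : x ∈ part a) (hy : y ∈ part b) :
    x * y = koszul a b • (y * x) := by
  rcases zmod_two_cases b with rfl | rfl
  · rw [mul_comm_even x hy, koszul_zero_right, one_smul]
  · rw [mul_comm_odd x hy, invol_of_mem hx, mul_smul_comm]

/-- The projection of a supernumber to its homogeneous part. -/
def proj (a : ZMod 2) : SuperNumber →L[ℝ] part a :=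
  ((1 / 2 : ℝ) • (ContinuousLinearMap.id ℝ SuperNumber + koszul a 1 • invol)).codRestrict (part a)
    (fun z I hI => by
      simp only [_root_.smul_apply, _root_.add_apply, ContinuousLinearMap.id_apply, coeff_smul,
        coeff_add, coeff_invol]
      rcases zmod_two_cases a with rfl | rfl
      · have : Odd I.card := by
          rw [← Nat.not_even_iff_odd]; exact fun h => hI ((ZMod.natCast_eq_zero_iff_even).2 h)
        simp [this.neg_one_pow]
      · have : Even I.card := by
          rw [← Nat.not_odd_iff_even]; exact fun h => hI ((ZMod.natCast_eq_one_iff_odd).2 h)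
        simp [this.neg_one_pow])

theorem coe_proj (a : ZMod 2) (z : SuperNumber) :
    (proj a z : SuperNumber) = (1 / 2 : ℝ) • (z + koszul a 1 • invol z) := rfl

theorem proj_of_mem {a : ZMod 2} {z : SuperNumber} (hz : z ∈ part a) :
    (proj a z : SuperNumber) = z := by
  rw [coe_proj, invol_of_mem hz, smul_smul, koszul_mul_self, one_smul, ← two_smul ℝ z, smul_smul]
  norm_num

theorem proj_add_proj (z : SuperNumber) :
    (proj 0 z : SuperNumber) + (proj 1 z : SuperNumber) = z := by
  rw [coe_proj, coe_proj, koszul_zero_left, koszul_one_one]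
  module

theorem body_proj_zero (z : SuperNumber) : body (proj 0 z : SuperNumber) = body z := by
  conv_rhs => rw [← proj_add_proj z, map_add, body_of_odd (proj 1 z).2, add_zero]

/-- The monomial `ζ^I`. -/
def monomial (I : Finset ℕ) : SuperNumber :=
  mk (fun J => if J = I then 1 else 0)
    (summable_of_ne_finset_zero (s := {I}) (by intro J hJ; simp_all))

theorem coeff_monomial (I J : Finset ℕ) : (monomial I).coeff J = if J = I then 1 else 0 := rfl

theorem monomial_mem_part (I : Finset ℕ) : monomial I ∈ part I.card := fun J hJ => by
  rw [coeff_monomial, if_neg]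
  rintro rfl
  exact hJ rfl

/-- Multiplication by a monomial in generators absent from `J` loses no information about the
coefficient at `J`: the only contributing splitting of `I ∪ J` is the obvious one. -/
theorem coeff_monomial_mul {I J : Finset ℕ} (h : Disjoint I J) (z : SuperNumber) :
    (monomial I * z).coeff (I ∪ J) = sgn I J * z.coeff J := by
  rw [coeff_mul, Finset.sum_eq_single I]
  · rw [coeff_monomial, if_pos rfl, mul_one, Finset.union_sdiff_cancel_left h]
  · intro A _ hA
    rw [coeff_monomial, if_neg hA, mul_zero, zero_mul]
  · intro hI
    exact absurd (Finset.mem_powerset.2 Finset.subset_union_left) hI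

theorem sgn_ne_zero (A B : Finset ℕ) : sgn A B ≠ 0 := by
  intro h
  have := abs_sgn A B
  simp [h] at this

/-- Membership in a homogeneous part can be tested by multiplying with homogeneous elements. -/
theorem mem_part_of_forall_mul {a b : ZMod 2} {z : SuperNumber}
    (h : ∀ x ∈ part a, x * z ∈ part b) : z ∈ part (a + b) := by
  rcases zmod_two_cases a with rfl | rfl
  · simpa using h 1 one_mem_part
  · intro I hI
    -- Infinitely many generators are essential: some `ζ^j` does not occur in `ζ^I`, and multiplying
    -- by it detects the coefficient at `I`. With finitely many generators the top monomial would be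
    -- annihilated by every odd element.
    obtain ⟨j, hj⟩ := Infinite.exists_notMem_finset I
    have hd : Disjoint {j} I := Finset.disjoint_singleton_left.2 hj
    have h1 := h (monomial {j}) (by simpa using monomial_mem_part {j}) ({j} ∪ I) (by
      rw [Finset.card_union_of_disjoint hd]
      intro h2
      apply hI
      rw [← h2, Finset.card_singleton, Nat.cast_add, ← add_assoc, Nat.cast_one]
      have : (1 + 1 : ZMod 2) = 0 := by decide
      rw [this, zero_add])
    rw [coeff_monomial_mul hd] at h1
    exact (mul_eq_zero.1 h1).resolve_left (sgn_ne_zero _ _)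

/-- All products vanish, hence lie in both homogeneous parts; so `z` lies in both as well, and these
meet only in zero. This gives uniqueness of partial derivatives, where an odd direction can be
tested only with odd increments. -/
theorem eq_zero_of_forall_mul {a : ZMod 2} {z : SuperNumber} (h : ∀ x ∈ part a, x * z = 0) :
    z = 0 := by
  have h0 : ∀ b, z ∈ part (a + b) :=
    fun b => mem_part_of_forall_mul fun x hx => by rw [h x hx]; exact zero_mem _
  have h1 : ∀ b, z ∈ part b := fun b => by simpa only [add_neg_cancel_left] using h0 (-a + b)
  ext I
  exact h1 (I.card + 1) I (by simp)

/-- The even supernumbers as a subalgebra. -/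
def evenSubalgebra : Subalgebra ℝ SuperNumber where
  carrier := part 0
  mul_mem' := fun ha hb => mul_mem_part ha hb
  add_mem' := fun ha hb => add_mem ha hb
  algebraMap_mem' := fun r => by
    rw [Algebra.algebraMap_eq_smul_one]
    exact (part 0).smul_mem r one_mem_part

instance : NormedCommRing evenSubalgebra :=
  { (inferInstance : NormedRing evenSubalgebra) with
    mul_comm := fun _ b => Subtype.ext (mul_comm_even _ b.2) }

instance : CompleteSpace evenSubalgebra := (isClosed_part 0).completeSpace_coe

theorem monomial_mul_self {I : Finset ℕ} (hI : I.Nonempty) : monomial I * monomial I = 0 := by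
  ext J
  rw [coeff_mul, coeff_zero]
  refine Finset.sum_eq_zero fun A hA => ?_
  rw [coeff_monomial, coeff_monomial]
  split_ifs with h2 h1
  · obtain ⟨x, hx⟩ := hI
    exact absurd (h2.symm ▸ hx : x ∈ A) (Finset.mem_sdiff.1 (h1.symm ▸ hx : x ∈ J \ A)).2
  all_goals simp

/-- Reduces membership in a closed subspace to membership of the terms `z_I ζ^I`. -/
theorem hasSum_coeff_smul_monomial (z : SuperNumber) :
    HasSum (fun I => z.coeff I • monomial I) z := by
  have h : HasSum (fun I => (lp.single 1 I (z.coeff I) : lp (fun _ : Finset ℕ => ℝ) 1)) z :=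
    lp.hasSum_single (E := fun _ : Finset ℕ => ℝ) (p := 1) (by simp) z
  have e : (fun I => z.coeff I • monomial I)
      = fun I => (lp.single 1 I (z.coeff I) : lp (fun _ : Finset ℕ => ℝ) 1) := by
    funext I
    refine SuperNumber.ext fun J => ?_
    rw [coeff_smul, coeff_monomial]
    change _ = (Pi.single I (z.coeff I) : Finset ℕ → ℝ) J
    by_cases hJ : J = I
    · subst hJ; simp
    · simp [hJ]
  rw [e]
  exact h

/-- An even supernumber is invertible if its body does not vanish. -/
theorem exists_even_inverse {z : SuperNumber} (hz : z ∈ part 0) (hb : body z ≠ 0) :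
    ∃ c ∈ part 0, z * c = 1 ∧ c * z = 1 := by
  by_cases hu : IsUnit (⟨z, hz⟩ : evenSubalgebra)
  · obtain ⟨c, hc⟩ := isUnit_iff_exists_inv.1 hu
    have h1 : z * (c : SuperNumber) = 1 := congrArg Subtype.val hc
    exact ⟨c, c.2, h1, by rw [← mul_comm_even _ c.2, h1]⟩
  -- A non-unit of the commutative Banach algebra of even supernumbers lies in a maximal ideal,
  -- which is closed. The soul `z - body z` will turn out to lie in that ideal too, hence so does
  -- the nonzero real number `body z`, a contradiction.
  · exfalso
    obtain ⟨𝔪, hm, hzm⟩ := exists_max_ideal_of_mem_nonunits hu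
    have hclosed : IsClosed (𝔪 : Set evenSubalgebra) := by
      rw [← Ideal.IsMaximal.closure_eq hm]
      exact isClosed_closure
    let S : Submodule ℝ SuperNumber := (𝔪.restrictScalars ℝ).map evenSubalgebra.val.toLinearMap
    have hS : IsClosed (S : Set SuperNumber) := by
      have : (S : Set SuperNumber) = Subtype.val '' (𝔪 : Set evenSubalgebra) := by
        ext x; simp [S]
      rw [this]
      exact (isClosed_part 0).isClosedEmbedding_subtypeVal.isClosedMap _ hclosed
    -- The soul is the limit of its finite partial sums. Its constant term is zero and its odd
    -- coefficients vanish; a nonempty even monomial squares to zero and so lies in every prime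
    -- ideal.
    have hsoul : z - body z • 1 ∈ S := by
      refine hS.mem_of_tendsto (hasSum_coeff_smul_monomial _) (Eventually.of_forall fun s => ?_)
      refine S.sum_mem fun I _ => ?_
      rcases I.eq_empty_or_nonempty with rfl | hI
      · simp [coeff_one, body_apply]
      · by_cases hp : (I.card : ZMod 2) = 0
        · have hI0 : monomial I ∈ part 0 := by
            rw [← hp]; exact monomial_mem_part I
          refine S.smul_mem _ ⟨⟨monomial I, hI0⟩, ?_, rfl⟩
          refine hm.isPrime.mem_of_pow_mem 2 ?_
          have : (⟨monomial I, hI0⟩ : evenSubalgebra) ^ 2 = 0 :=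
            Subtype.ext (by rw [pow_two]; exact monomial_mul_self hI)
          rw [this]
          exact 𝔪.zero_mem
        · rw [coeff_sub, coeff_smul, coeff_one, if_neg hI.ne_empty, hz I hp]
          simp
    have hzS : z ∈ S := ⟨⟨z, hz⟩, hzm, rfl⟩
    obtain ⟨y, hy, hy1⟩ : (1 : SuperNumber) ∈ S := by
      have h := S.smul_mem (body z)⁻¹ (S.sub_mem hzS hsoul)
      rwa [sub_sub_cancel, smul_smul, inv_mul_cancel₀ hb, one_smul] at h
    have : y = 1 := Subtype.ext hy1
    exact hm.ne_top ((Ideal.eq_top_iff_one _).2 (this ▸ hy))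

end SuperNumber

/-! ### Calculus of superdifferentiable functions. -/

section Calculus

variable {m n : ℕ}

/-- The `k`-th coordinate as a continuous linear map. -/
def coordCLM (k : Fin m ⊕ Fin n) : SuperSpace m n →L[ℝ] SuperNumber :=
  (part (parity k)).subtypeL.comp
    (PiLp.proj 1 (𝕜 := ℝ) (fun k : Fin m ⊕ Fin n => part (parity k)) k)

/-- The continuous linear map `h ↦ ∑ h^k * c k`. -/
def superLinear (c : Fin m ⊕ Fin n → SuperNumber) : SuperSpace m n →L[ℝ] SuperNumber :=
  ∑ k, ((ContinuousLinearMap.mul ℝ SuperNumber).flip (c k)).comp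
    (coordCLM k)

@[simp] theorem superLinear_apply (c : Fin m ⊕ Fin n → SuperNumber) (h : SuperSpace m n) :
    superLinear c h = ∑ k, (h k : SuperNumber) * c k := by
  simp [superLinear, coordCLM]

theorem hasSuperDerivAt_iff {f : SuperSpace m n → SuperNumber} {f' : Fin m ⊕ Fin n → SuperNumber}
    {x : SuperSpace m n} : HasSuperDerivAt f f' x ↔ HasFDerivAt f (superLinear f') x := by
  constructor
  · rintro ⟨L, hL, hf⟩
    rwa [show superLinear f' = L from ContinuousLinearMap.ext fun h => by rw [hL, superLinear_apply]]
  · exact fun h => ⟨_, superLinear_apply f', h⟩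

/-- The vector with `k`-th coordinate `c` and all other coordinates zero. -/
def coordVector (k : Fin m ⊕ Fin n) (c : part (parity k)) : SuperSpace m n :=
  WithLp.toLp 1 (Pi.single k c)

theorem superLinear_coordVector (c : Fin m ⊕ Fin n → SuperNumber) (k : Fin m ⊕ Fin n)
    (h : part (parity k)) : superLinear c (coordVector k h) = h * c k := by
  rw [superLinear_apply, Finset.sum_eq_single k]
  · simp [coordVector]
  · intro j _ hj
    simp [coordVector, hj]
  · simp

theorem superLinear_injective :
    Function.Injective (superLinear : (Fin m ⊕ Fin n → SuperNumber) → _) := by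
  intro c d h
  funext k
  rw [← sub_eq_zero]
  refine eq_zero_of_forall_mul (a := parity k) fun x hx => ?_
  have := congrArg (fun L => L (coordVector k ⟨x, hx⟩)) h
  simp only [superLinear_coordVector] at this
  rw [mul_sub, this, sub_self]

theorem HasSuperDerivAt.unique {f : SuperSpace m n → SuperNumber}
    {f₁ f₂ : Fin m ⊕ Fin n → SuperNumber} {x : SuperSpace m n} (h₁ : HasSuperDerivAt f f₁ x)
    (h₂ : HasSuperDerivAt f f₂ x) : f₁ = f₂ :=
  superLinear_injective ((hasSuperDerivAt_iff.1 h₁).unique (hasSuperDerivAt_iff.1 h₂))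

theorem HasSuperDerivAt.congr_of_eventuallyEq {f g : SuperSpace m n → SuperNumber}
    {f' : Fin m ⊕ Fin n → SuperNumber} {x : SuperSpace m n} (h : HasSuperDerivAt f f' x)
    (hfg : g =ᶠ[𝓝 x] f) : HasSuperDerivAt g f' x :=
  hasSuperDerivAt_iff.2 ((hasSuperDerivAt_iff.1 h).congr_of_eventuallyEq hfg)

theorem HasSuperDerivAt.add {f g : SuperSpace m n → SuperNumber}
    {f' g' : Fin m ⊕ Fin n → SuperNumber} {x : SuperSpace m n} (hf : HasSuperDerivAt f f' x)
    (hg : HasSuperDerivAt g g' x) : HasSuperDerivAt (fun x => f x + g x) (fun k => f' k + g' k) x := by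
  obtain ⟨L, hL, hL'⟩ := hf
  obtain ⟨N, hN, hN'⟩ := hg
  exact ⟨L + N, fun h => by simp [hL, hN, mul_add, Finset.sum_add_distrib], hL'.add hN'⟩

theorem hasSuperDerivAt_const (c : SuperNumber) (x : SuperSpace m n) :
    HasSuperDerivAt (fun _ => c) (fun _ => 0) x :=
  ⟨0, by simp, hasFDerivAt_const c x⟩

/-- The product rule, for a first factor which is homogeneous at the given point. -/
theorem HasSuperDerivAt.mul {f g : SuperSpace m n → SuperNumber}
    {f' g' : Fin m ⊕ Fin n → SuperNumber} {x : SuperSpace m n} (hf : HasSuperDerivAt f f' x)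
    (hg : HasSuperDerivAt g g' x) {b : ZMod 2} (hb : f x ∈ part b) :
    HasSuperDerivAt (fun x => f x * g x)
      (fun k => f' k * g x + koszul (parity k) b • (f x * g' k)) x := by
  obtain ⟨L, hL, hL'⟩ := hf
  obtain ⟨N, hN, hN'⟩ := hg
  refine ⟨_, fun h => ?_, hL'.mul' hN'⟩
  simp only [_root_.add_apply, _root_.smul_apply, MulOpposite.smul_eq_mul_unop,
    MulOpposite.unop_op, hL, hN, smul_eq_mul, Finset.sum_mul, Finset.mul_sum, mul_add,
    Finset.sum_add_distrib]
  rw [add_comm]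
  congr 1
  · simp only [mul_assoc]
  · refine Finset.sum_congr rfl fun k _ => ?_
    rw [← mul_assoc, mul_comm_of_mem hb (h k).2, mul_smul_comm, smul_mul_assoc, mul_assoc,
      koszul_comm]

/-- The derivative of a function with values in a homogeneous part. -/
theorem HasSuperDerivAt.mem_part {f : SuperSpace m n → SuperNumber}
    {f' : Fin m ⊕ Fin n → SuperNumber} {x : SuperSpace m n} (hf : HasSuperDerivAt f f' x)
    {b : ZMod 2} (hb : ∀ᶠ y in 𝓝 x, f y ∈ part b) (k : Fin m ⊕ Fin n) :
    f' k ∈ part (parity k + b) := by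
  refine mem_part_of_forall_mul fun y hy I hI => ?_
  -- For `I` of the wrong parity the `I`-th coefficient of `f` vanishes near `x`, so its derivative
  -- in the direction of any increment of the `k`-th coordinate is zero.
  have h1 : HasFDerivAt (fun y => coeffCLM I (f y)) ((coeffCLM I).comp (superLinear f')) x :=
    (coeffCLM I).hasFDerivAt.comp x (hasSuperDerivAt_iff.1 hf)
  have h2 : HasFDerivAt (fun y => coeffCLM I (f y)) (0 : SuperSpace m n →L[ℝ] ℝ) x :=
    (hasFDerivAt_const (0 : ℝ) x).congr_of_eventuallyEq (hb.mono fun y hy => hy I hI)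
  have h3 := congrArg (fun L => L (coordVector k ⟨y, hy⟩)) (h1.unique h2)
  simpa only [ContinuousLinearMap.comp_apply, superLinear_coordVector, coeffCLM_apply,
    _root_.zero_apply] using h3

open Classical in
/-- The `k`-th partial derivative of `f` (zero where `f` is not superdifferentiable). -/
def superDeriv (k : Fin m ⊕ Fin n) (f : SuperSpace m n → SuperNumber) (x : SuperSpace m n) :
    SuperNumber :=
  if h : ∃ f', HasSuperDerivAt f f' x then h.choose k else 0

theorem HasSuperDerivAt.superDeriv_eq {f : SuperSpace m n → SuperNumber}
    {f' : Fin m ⊕ Fin n → SuperNumber} {x : SuperSpace m n} (h : HasSuperDerivAt f f' x)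
    (k : Fin m ⊕ Fin n) : superDeriv k f x = f' k := by
  have hex : ∃ f', HasSuperDerivAt f f' x := ⟨f', h⟩
  rw [superDeriv, dif_pos hex, hex.choose_spec.unique h]

theorem superDeriv_congr {f g : SuperSpace m n → SuperNumber} {x : SuperSpace m n}
    (hfg : f =ᶠ[𝓝 x] g) (k : Fin m ⊕ Fin n) : superDeriv k f x = superDeriv k g x := by
  by_cases hex : ∃ f', HasSuperDerivAt f f' x
  · obtain ⟨f', h⟩ := hex
    rw [h.superDeriv_eq, (h.congr_of_eventuallyEq hfg.symm).superDeriv_eq]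
  · have hex' : ¬ ∃ f', HasSuperDerivAt g f' x :=
      fun ⟨f', h⟩ => hex ⟨f', h.congr_of_eventuallyEq hfg⟩
    rw [superDeriv, superDeriv, dif_neg hex, dif_neg hex']

theorem IsG.congr {U : Set (SuperSpace m n)} (hU : IsOpen U) {r : ℕ}
    {f g : SuperSpace m n → SuperNumber} (hf : IsG r f U) (hfg : ∀ x ∈ U, g x = f x) :
    IsG r g U := by
  cases r with
  | zero => exact ContinuousOn.congr hf hfg
  | succ r =>
    obtain ⟨f', h1, h2⟩ := hf
    exact ⟨f', h1, fun x hx => (h2 x hx).congr_of_eventuallyEq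
      (eventually_of_mem (hU.mem_nhds hx) hfg)⟩

theorem IsG.sum {U : Set (SuperSpace m n)} {r : ℕ} {ι : Type*} (s : Finset ι)
    {f : ι → SuperSpace m n → SuperNumber} (hf : ∀ i ∈ s, IsG r (f i) U) :
    IsG r (fun x => ∑ i ∈ s, f i x) U := by
  classical
  induction s using Finset.induction_on with
  | empty => simpa using isG_const 0 U r
  | insert i s hi ih =>
    simp only [Finset.sum_insert hi]
    exact (hf i (Finset.mem_insert_self i s)).add
      (ih fun j hj => hf j (Finset.mem_insert_of_mem hj))

theorem IsG.continuousOn {U : Set (SuperSpace m n)} {f : SuperSpace m n → SuperNumber} :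
    ∀ {r : ℕ}, IsG r f U → ContinuousOn f U
  | 0, h => h
  | _ + 1, h => h.of_succ.continuousOn

theorem IsG.superDeriv {U : Set (SuperSpace m n)} (hU : IsOpen U) {r : ℕ}
    {f : SuperSpace m n → SuperNumber} (hf : IsG (r + 1) f U) (k : Fin m ⊕ Fin n) :
    IsG r (superDeriv k f) U := by
  obtain ⟨f', h1, h2⟩ := hf
  exact (h1 k).congr hU fun x hx => (h2 x hx).superDeriv_eq k

theorem IsG.hasSuperDerivAt {U : Set (SuperSpace m n)} {r : ℕ}
    {f : SuperSpace m n → SuperNumber} (hf : IsG (r + 1) f U) {x : SuperSpace m n} (hx : x ∈ U) :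
    HasSuperDerivAt f (fun k => SuperGeometry.superDeriv k f x) x := by
  obtain ⟨f', _, h2⟩ := hf
  have : (fun k => SuperGeometry.superDeriv k f x) = fun k => f' k x :=
    funext fun k => (h2 x hx).superDeriv_eq k
  rw [this]
  exact h2 x hx

theorem hasSuperDerivAt_coord (k : Fin m ⊕ Fin n) (x : SuperSpace m n) :
    HasSuperDerivAt (fun y => (y k : SuperNumber)) (Pi.single k 1) x := by
  refine ⟨coordCLM k, fun h => ?_, (coordCLM k).hasFDerivAt⟩
  rw [Finset.sum_eq_single k]
  · simp [coordCLM]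
  · intro j _ hj
    simp [hj]
  · simp

theorem isG_coord (k : Fin m ⊕ Fin n) (U : Set (SuperSpace m n)) (r : ℕ) :
    IsG r (fun y => (y k : SuperNumber)) U := by
  cases r with
  | zero => exact (coordCLM k).continuous.continuousOn
  | succ r => exact ⟨fun j _ => (Pi.single k 1 : _ → SuperNumber) j, fun j => isG_const _ U r,
      fun x _ => hasSuperDerivAt_coord k x⟩

theorem continuousOn_of_coords {X : Type*} [TopologicalSpace X] {φ : X → SuperSpace m n} {U : Set X}
    (h : ∀ k, ContinuousOn (fun x => (φ x k : SuperNumber)) U) : ContinuousOn φ U := by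
  have h1 : ContinuousOn (fun x => (φ x).ofLp) U :=
    continuousOn_pi.2 fun k => continuousOn_iff_continuous_domRestrict.2
      (continuous_induced_rng.2 (continuousOn_iff_continuous_domRestrict.1 (h k)))
  exact (PiLp.continuous_toLp 1 _).comp_continuousOn h1

/-- The chain rule needs a derivative of `φ` as a map into superspace, while the hypothesis concerns
its coordinates as supernumber-valued functions. Projecting to the homogeneous part restores the
codomain; uniqueness of derivatives shows that the projection does not alter the formula. -/
theorem hasFDerivAt_of_coords {φ : SuperSpace m n → SuperSpace m n}
    {φ' : Fin m ⊕ Fin n → Fin m ⊕ Fin n → SuperNumber} {x : SuperSpace m n}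
    (h : ∀ k, HasSuperDerivAt (fun y => (φ y k : SuperNumber)) (φ' k) x) :
    ∃ L : SuperSpace m n →L[ℝ] SuperSpace m n, HasFDerivAt φ L x ∧
      ∀ v k, (L v k : SuperNumber) = ∑ l, (v l : SuperNumber) * φ' k l := by
  have h1 : ∀ k, HasFDerivAt (fun y => φ y k) ((proj (parity k)).comp (superLinear (φ' k))) x := by
    intro k
    have := (proj (parity k)).hasFDerivAt.comp x (hasSuperDerivAt_iff.1 (h k))
    refine this.congr_of_eventuallyEq (Eventually.of_forall fun y => ?_)
    exact Subtype.ext (proj_of_mem (φ y k).2).symm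
  have h2 : ∀ k, (part (parity k)).subtypeL.comp ((proj (parity k)).comp (superLinear (φ' k)))
      = superLinear (φ' k) := fun k =>
    ((part (parity k)).subtypeL.hasFDerivAt.comp x (h1 k)).unique (hasSuperDerivAt_iff.1 (h k))
  have h3 := hasFDerivAt_pi.2 h1
  refine ⟨_, ((PiLp.continuousLinearEquiv 1 ℝ
    (fun k : Fin m ⊕ Fin n => part (parity k))).symm.hasFDerivAt.comp x h3), fun v k => ?_⟩
  have := congrArg (fun L => L v) (h2 k)
  rw [superLinear_apply] at this
  exact this

theorem HasSuperDerivAt.comp {F : SuperSpace m n → SuperNumber} {φ : SuperSpace m n → SuperSpace m n}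
    {F' : Fin m ⊕ Fin n → SuperNumber} {φ' : Fin m ⊕ Fin n → Fin m ⊕ Fin n → SuperNumber}
    {x : SuperSpace m n} (hF : HasSuperDerivAt F F' (φ x))
    (h : ∀ k, HasSuperDerivAt (fun y => (φ y k : SuperNumber)) (φ' k) x) :
    HasSuperDerivAt (fun y => F (φ y)) (fun l => ∑ k, φ' k l * F' k) x := by
  obtain ⟨L, hL, hL'⟩ := hasFDerivAt_of_coords h
  refine ⟨_, fun v => ?_, (hasSuperDerivAt_iff.1 hF).comp x hL⟩
  rw [ContinuousLinearMap.comp_apply, superLinear_apply]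
  simp only [hL', Finset.sum_mul, Finset.mul_sum, mul_assoc]
  rw [Finset.sum_comm]

theorem IsG.comp {U W : Set (SuperSpace m n)} {φ : SuperSpace m n → SuperSpace m n}
    (hφ : Set.MapsTo φ U W) : ∀ {r : ℕ} {F : SuperSpace m n → SuperNumber},
      (∀ k, IsG r (fun x => (φ x k : SuperNumber)) U) → IsG r F W → IsG r (fun x => F (φ x)) U
  | 0, _, h, hF => ContinuousOn.comp hF (continuousOn_of_coords h) hφ
  | r + 1, F, h, ⟨F', hF1, hF2⟩ => by
    choose φ' hφ1 hφ2 using h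
    refine ⟨fun l x => ∑ k, φ' k l x * F' k (φ x), fun l => IsG.sum _ fun k _ =>
      (hφ1 k l).mul (IsG.comp hφ (fun k => IsG.of_succ ⟨φ' k, hφ1 k, hφ2 k⟩) (hF1 k)), fun x hx => ?_⟩
    exact (hF2 _ (hφ hx)).comp fun k => hφ2 k x hx

/-- The derivative of `1/f` is `-f⁻¹ (df) f⁻¹`. Since `f⁻¹` is even, the increment `h^k` can be
moved to the left of it, which is the form a superderivative must have. -/
theorem IsG.ringInverse {U : Set (SuperSpace m n)} : ∀ {r : ℕ} {f : SuperSpace m n → SuperNumber},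
    IsG r f U → (∀ x ∈ U, IsUnit (f x) ∧ Ring.inverse (f x) ∈ part 0) →
      IsG r (fun x => Ring.inverse (f x)) U
  | 0, f, hf, hu => fun x hx => by
    obtain ⟨u, hu⟩ := (hu x hx).1
    have h := NormedRing.inverse_continuousAt u
    rw [hu] at h
    exact h.comp_continuousWithinAt (hf x hx)
  | r + 1, f, hf, hu => by
    have hi := hf.of_succ.ringInverse hu
    obtain ⟨f', h1, h2⟩ := hf
    refine ⟨fun k x => (-1 : ℝ) • (Ring.inverse (f x) * f' k x * Ring.inverse (f x)),
      fun k => isG_const_smul _ ((hi.mul (h1 k)).mul hi), fun x hx => ?_⟩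
    obtain ⟨⟨u, hxu⟩, hpart⟩ := hu x hx
    have hd := hasFDerivAt_ringInverse (𝕜 := ℝ) u
    rw [← Ring.inverse_unit, hxu] at hd
    refine ⟨_, fun h => ?_, hd.comp x (hasSuperDerivAt_iff.1 (h2 x hx))⟩
    simp only [ContinuousLinearMap.comp_apply, superLinear_apply, _root_.neg_apply,
      ContinuousLinearMap.mulLeftRight_apply, Finset.mul_sum, Finset.sum_mul]
    rw [← Finset.sum_neg_distrib]
    refine Finset.sum_congr rfl fun k _ => ?_
    rw [← mul_assoc, ← mul_comm_even _ hpart]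
    simp [mul_assoc]

theorem continuous_superLinear :
    Continuous (superLinear : (Fin m ⊕ Fin n → SuperNumber) → SuperSpace m n →L[ℝ] SuperNumber) := by
  unfold superLinear
  refine continuous_finsetSum _ fun k _ => ?_
  exact (((ContinuousLinearMap.mul ℝ SuperNumber).flip.continuous.comp
    (continuous_apply k))).clm_comp continuous_const

/-! ### Averages over segments and Hadamard's lemma. -/

/-- The weighted average of `f` over the segment from `x₀` to `x`. -/
def segmentAverage {H E : Type*} [NormedAddCommGroup H] [NormedSpace ℝ H] [NormedAddCommGroup E]
    [NormedSpace ℝ E] (x₀ : H) (j : ℕ) (f : H → E) (x : H) : E :=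
  ∫ t in (0 : ℝ)..1, t ^ j • f (x₀ + t • (x - x₀))

section Segment

variable {H E : Type*} [NormedAddCommGroup H] [NormedSpace ℝ H] [NormedAddCommGroup E]
  [NormedSpace ℝ E] {x₀ : H} {ρ : ℝ}

theorem segment_mem_ball {x : H} (hx : x ∈ Metric.ball x₀ ρ) {t : ℝ}
    (ht : t ∈ Set.Icc (0 : ℝ) 1) : x₀ + t • (x - x₀) ∈ Metric.ball x₀ ρ :=
  (convex_ball x₀ ρ).add_smul_sub_mem
    (Metric.mem_ball_self (dist_nonneg.trans_lt (Metric.mem_ball.1 hx))) hx ht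

theorem continuousOn_segment {E : Type*} [TopologicalSpace E] {f : H → E}
    (hf : ContinuousOn f (Metric.ball x₀ ρ)) {x : H} (hx : x ∈ Metric.ball x₀ ρ) :
    ContinuousOn (fun t : ℝ => f (x₀ + t • (x - x₀))) (Set.Icc 0 1) :=
  hf.comp (by fun_prop) fun _ ht => segment_mem_ball hx ht

theorem continuousOn_weighted_segment {f : H → E} (hf : ContinuousOn f (Metric.ball x₀ ρ)) (i : ℕ)
    {x : H} (hx : x ∈ Metric.ball x₀ ρ) :
    ContinuousOn (fun t : ℝ => t ^ i • f (x₀ + t • (x - x₀))) (Set.uIcc 0 1) := by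
  rw [Set.uIcc_of_le zero_le_one]
  exact (continuous_pow i).continuousOn.smul (continuousOn_segment hf hx)

theorem aestronglyMeasurable_weighted_segment {f : H → E} (hf : ContinuousOn f (Metric.ball x₀ ρ)) (i : ℕ)
    {x : H} (hx : x ∈ Metric.ball x₀ ρ) :
    MeasureTheory.AEStronglyMeasurable (fun t : ℝ => t ^ i • f (x₀ + t • (x - x₀)))
      (MeasureTheory.volume.restrict (Set.uIoc 0 1)) :=
  ((continuousOn_weighted_segment hf i hx).mono Set.uIoc_subset_uIcc).aestronglyMeasurable
    measurableSet_uIoc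

/-- Supplies the dominating constant for differentiation under the integral. Compactness is that of
`[0, 1]`, in the style of the tube lemma; balls of `H` need not be relatively compact. -/
theorem eventually_segment_le {f : H → ℝ} (hf : ContinuousOn f (Metric.ball x₀ ρ))
    {x : H} (hx : x ∈ Metric.ball x₀ ρ) :
    ∃ C, ∀ᶠ y in 𝓝 x, ∀ t ∈ Set.Icc (0 : ℝ) 1, f (x₀ + t • (y - x₀)) ≤ C := by
  obtain ⟨C, hC⟩ := isCompact_Icc.exists_bound_of_continuousOn (continuousOn_segment hf hx)
  refine ⟨C + 1, isCompact_Icc.eventually_forall_of_forall_eventually fun t ht => ?_⟩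
  have h1 : ContinuousAt (fun z : H × ℝ => x₀ + z.2 • (z.1 - x₀)) (x, t) := by
    fun_prop
  have h2 := hf.continuousAt (Metric.isOpen_ball.mem_nhds (segment_mem_ball hx ht))
  have h3 := ContinuousAt.comp (f := fun z : H × ℝ => x₀ + z.2 • (z.1 - x₀))
    (x := (x, t)) h2 h1
  exact (h3.eventually_lt_const (((le_abs_self _).trans (hC t ht)).trans_lt
    (lt_add_one C))).mono fun z hz => hz.le

/-- Differentiation under the integral sign. The chain rule contributes a factor `t`, which raises
the weight from `t ^ j` to `t ^ (j + 1)`; the weights make the class of averages closed under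
differentiation. -/
theorem hasFDerivAt_segmentAverage (j : ℕ) {f : H → E}
    {f' : H → H →L[ℝ] E}
    (hf' : ContinuousOn f' (Metric.ball x₀ ρ))
    (hf : ∀ x ∈ Metric.ball x₀ ρ, HasFDerivAt f (f' x) x)
    {x : H} (hx : x ∈ Metric.ball x₀ ρ) :
    ∃ L : H →L[ℝ] E, HasFDerivAt (segmentAverage x₀ j f) L x ∧
      ∀ h, L h = ∫ t in (0 : ℝ)..1, t ^ (j + 1) • f' (x₀ + t • (x - x₀)) h := by
  have hfc : ContinuousOn f (Metric.ball x₀ ρ) := fun y hy =>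
    (hf y hy).continuousAt.continuousWithinAt
  have hLn : ContinuousOn (fun y => ‖f' y‖) (Metric.ball x₀ ρ) :=
    hf'.norm
  obtain ⟨C, hC⟩ := eventually_segment_le hLn hx
  have hball : Metric.ball x₀ ρ ∈ 𝓝 x := Metric.isOpen_ball.mem_nhds hx
  have hI : ∀ t ∈ Set.uIoc (0 : ℝ) 1, t ∈ Set.Icc (0 : ℝ) 1 := fun t ht => by
    rw [← Set.uIcc_of_le zero_le_one]
    exact Set.uIoc_subset_uIcc ht
  refine ⟨_, intervalIntegral.hasFDerivAt_integral_of_dominated_of_fderiv_le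
    (𝕜 := ℝ) (μ := MeasureTheory.volume) (a := 0) (b := 1) (x₀ := x)
    (F := fun y t => t ^ j • f (x₀ + t • (y - x₀)))
    (F' := fun y t => t ^ (j + 1) • f' (x₀ + t • (y - x₀)))
    (bound := fun _ => C) (inter_mem hC hball)
    (eventually_of_mem hball fun y hy => aestronglyMeasurable_weighted_segment hfc j hy)
    ((continuousOn_weighted_segment hfc j hx).intervalIntegrable)
    (aestronglyMeasurable_weighted_segment hf' (j + 1) hx)
    (Eventually.of_forall fun t ht y hy => ?_) intervalIntegrable_const
    (Eventually.of_forall fun t ht y hy => ?_), fun h => ?_⟩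
  · rw [norm_smul, norm_pow, Real.norm_of_nonneg (hI t ht).1]
    exact (mul_le_of_le_one_left (norm_nonneg _) (pow_le_one₀ (hI t ht).1 (hI t ht).2)).trans
      (hy.1 t (hI t ht))
  · have h1 : HasFDerivAt (fun y : H => x₀ + t • (y - x₀))
        (t • ContinuousLinearMap.id ℝ (H)) y :=
      (((hasFDerivAt_id y).sub_const x₀).const_smul t).const_add x₀
    have h2 := ((hf _ (segment_mem_ball hy.2 (hI t ht))).comp y h1).const_smul (t ^ j)
    have e : t ^ (j + 1) • f' (x₀ + t • (y - x₀)) = t ^ j •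
        (f' (x₀ + t • (y - x₀))).comp (t • ContinuousLinearMap.id ℝ (H)) := by
      ext v
      simp [pow_succ, mul_smul]
    rw [e]
    exact h2
  · rw [ContinuousLinearMap.intervalIntegral_apply
      (continuousOn_weighted_segment hf' (j + 1) hx).intervalIntegrable]
    rfl

end Segment

variable {x₀ : SuperSpace m n} {ρ : ℝ}

theorem hasSuperDerivAt_segmentAverage (j : ℕ) {f : SuperSpace m n → SuperNumber}
    {f' : Fin m ⊕ Fin n → SuperSpace m n → SuperNumber}
    (hf' : ∀ k, ContinuousOn (f' k) (Metric.ball x₀ ρ))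
    (hf : ∀ x ∈ Metric.ball x₀ ρ, HasSuperDerivAt f (fun k => f' k x) x)
    {x : SuperSpace m n} (hx : x ∈ Metric.ball x₀ ρ) :
    HasSuperDerivAt (segmentAverage x₀ j f) (fun k => segmentAverage x₀ (j + 1) (f' k) x) x := by
  have hLc : ContinuousOn (fun y => superLinear (fun k => f' k y)) (Metric.ball x₀ ρ) :=
    continuous_superLinear.comp_continuousOn (continuousOn_pi.2 hf')
  obtain ⟨L, hL, hL'⟩ :=
    hasFDerivAt_segmentAverage j hLc (fun y hy => hasSuperDerivAt_iff.1 (hf y hy)) hx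
  refine ⟨L, fun h => ?_, hL⟩
  rw [hL']
  simp only [superLinear_apply, Finset.smul_sum]
  rw [intervalIntegral.integral_finsetSum]
  · refine Finset.sum_congr rfl fun k _ => ?_
    have := (ContinuousLinearMap.mul ℝ SuperNumber (h k)).intervalIntegral_comp_comm
      (continuousOn_weighted_segment (hf' k) (j + 1) hx).intervalIntegrable
      (μ := MeasureTheory.volume)
    simp only [ContinuousLinearMap.mul_apply', mul_smul_comm] at this
    exact this
  · intro k _
    have := continuousOn_weighted_segment (f := fun y => (h k : SuperNumber) * f' k y)
      (continuousOn_const.mul (hf' k)) (j + 1) hx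
    exact this.intervalIntegrable

/-- One degree of smoothness is given up so that at the bottom of the induction continuity follows
from differentiability; for `G^∞` functions nothing is lost. The weight must vary, since each
derivative increases it. -/
theorem IsG.segmentAverage : ∀ {r : ℕ} {f : SuperSpace m n → SuperNumber} (j : ℕ),
    IsG (r + 1) f (Metric.ball x₀ ρ) → IsG r (segmentAverage x₀ j f) (Metric.ball x₀ ρ)
  | 0, _, j, ⟨_, h1, h2⟩ => fun _ hx =>
    (hasSuperDerivAt_iff.1 (hasSuperDerivAt_segmentAverage j (fun k => (h1 k).continuousOn) h2
      hx)).continuousAt.continuousWithinAt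
  | _ + 1, _, j, ⟨f', h1, h2⟩ =>
    ⟨fun k => SuperGeometry.segmentAverage x₀ (j + 1) (f' k),
      fun k => IsG.segmentAverage (j + 1) (h1 k), fun _ hx =>
        hasSuperDerivAt_segmentAverage j (fun k => (h1 k).continuousOn) h2 hx⟩

/-- Hadamard's lemma for `G^∞` functions. -/
theorem IsGInfty.hadamard {f : SuperSpace m n → SuperNumber}
    (hf : IsGInfty f (Metric.ball x₀ ρ)) :
    ∃ F : Fin m ⊕ Fin n → SuperSpace m n → SuperNumber,
      (∀ k, IsGInfty (F k) (Metric.ball x₀ ρ)) ∧ ∀ x ∈ Metric.ball x₀ ρ,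
        f x = f x₀ + ∑ k, ((x k : SuperNumber) - (x₀ k : SuperNumber)) * F k x := by
  have hf' : ∀ k, IsGInfty (superDeriv k f) (Metric.ball x₀ ρ) :=
    fun k r => (hf (r + 1)).superDeriv Metric.isOpen_ball k
  refine ⟨fun k => segmentAverage x₀ 0 (superDeriv k f), fun k r =>
    IsG.segmentAverage 0 (hf' k (r + 1)), fun x hx => ?_⟩
  have hterm : ∀ k, ContinuousOn (fun t : ℝ => ((x - x₀) k : SuperNumber)
      * superDeriv k f (x₀ + t • (x - x₀))) (Set.uIcc 0 1) := fun k => by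
    rw [Set.uIcc_of_le zero_le_one]
    exact continuousOn_const.mul (continuousOn_segment (hf' k 0) hx)
  -- The fundamental theorem of calculus along the segment: integrating this derivative gives `f x -
  -- f x₀`, and each summand is a coordinate difference times an average of a partial derivative.
  have hd : ∀ t ∈ Set.uIcc (0 : ℝ) 1, HasDerivAt (fun t : ℝ => f (x₀ + t • (x - x₀)))
      (∑ k, ((x - x₀) k : SuperNumber) * superDeriv k f (x₀ + t • (x - x₀))) t := by
    intro t ht
    rw [Set.uIcc_of_le zero_le_one] at ht
    have h1 : HasDerivAt (fun t : ℝ => x₀ + t • (x - x₀)) (x - x₀) t := by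
      simpa using ((hasDerivAt_id t).smul_const (x - x₀)).const_add x₀
    have h2 := (hasSuperDerivAt_iff.1 ((hf 1).hasSuperDerivAt (segment_mem_ball hx ht))).comp_hasDerivAt
      t h1
    rwa [superLinear_apply] at h2
  have h := intervalIntegral.integral_eq_sub_of_hasDerivAt hd
    (continuousOn_finsetSum _ fun k _ => hterm k).intervalIntegrable
  rw [intervalIntegral.integral_finsetSum fun k _ => (hterm k).intervalIntegrable] at h
  simp only [one_smul, zero_smul, add_zero, add_sub_cancel] at h
  rw [← sub_eq_iff_eq_add', ← h]
  refine Finset.sum_congr rfl fun k _ => ?_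
  have h3 : IntervalIntegrable (fun t : ℝ => superDeriv k f (x₀ + t • (x - x₀)))
      MeasureTheory.volume 0 1 := by
    refine ContinuousOn.intervalIntegrable ?_
    rw [Set.uIcc_of_le zero_le_one]
    exact continuousOn_segment (hf' k 0) hx
  have h4 := (ContinuousLinearMap.mul ℝ SuperNumber ((x - x₀) k)).intervalIntegral_comp_comm h3
  simp only [ContinuousLinearMap.mul_apply'] at h4
  rw [h4]
  simp [segmentAverage]

end Calculus

section Manifold

variable {m n : ℕ} {M : Type*} [TopologicalSpace M] [ChartedSpace (SuperSpace m n) M]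

/-! ## Functions on a supermanifold -/

theorem IsGInftyOn.mono {f : M → SuperNumber} {U V : Set M} (hf : IsGInftyOn m n f U)
    (hVU : V ⊆ U) : IsGInftyOn m n f V := fun e he r =>
  (hf e he r).mono (Set.inter_subset_inter_right _ (Set.preimage_mono hVU))

theorem IsGInftyOn.isGInftyAt {f : M → SuperNumber} {U : Set M} (hf : IsGInftyOn m n f U)
    (hU : IsOpen U) {p : M} (hp : p ∈ U) : IsGInftyAt m n f p :=
  ⟨U, hU, hp, hf⟩

theorem IsGInftyOn.congr {f g : M → SuperNumber} {U : Set M} (hf : IsGInftyOn m n f U)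
    (hU : IsOpen U) (hfg : ∀ q ∈ U, g q = f q) : IsGInftyOn m n g U := fun e he r =>
  (hf e he r).congr (e.symm.isOpen_inter_preimage hU) fun _ hx => hfg _ hx.2

theorem IsGInftyOn.const (c : SuperNumber) (U : Set M) : IsGInftyOn m n (fun _ => c) U :=
  fun _ _ r => isG_const c _ r

theorem IsGInftyOn.add {f g : M → SuperNumber} {U : Set M} (hf : IsGInftyOn m n f U)
    (hg : IsGInftyOn m n g U) : IsGInftyOn m n (fun q => f q + g q) U :=
  fun e he r => (hf e he r).add (hg e he r)

theorem IsGInftyOn.mul {f g : M → SuperNumber} {U : Set M} (hf : IsGInftyOn m n f U)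
    (hg : IsGInftyOn m n g U) : IsGInftyOn m n (fun q => f q * g q) U :=
  fun e he r => (hf e he r).mul (hg e he r)

theorem IsGInftyOn.neg {f : M → SuperNumber} {U : Set M} (hf : IsGInftyOn m n f U) :
    IsGInftyOn m n (fun q => -f q) U := by
  simpa using (IsGInftyOn.const (-1) U).mul hf

theorem IsGInftyOn.ringInverse {f : M → SuperNumber} {U : Set M} (hf : IsGInftyOn m n f U)
    (hu : ∀ q ∈ U, IsUnit (f q) ∧ Ring.inverse (f q) ∈ part 0) :
    IsGInftyOn m n (fun q => Ring.inverse (f q)) U :=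
  fun e he r => (hf e he r).ringInverse fun _ hx => hu _ hx.2

theorem IsGInftyOn.continuousOn {f : M → SuperNumber} {U : Set M} (hU : IsOpen U)
    (hf : IsGInftyOn m n f U) : ContinuousOn f U := by
  intro q hq
  refine ContinuousAt.continuousWithinAt ?_
  let e := chartAt (SuperSpace m n) q
  have hqs : q ∈ e.source := mem_chart_source _ q
  have h1 : ContinuousAt (fun x => f (e.symm x)) (e q) :=
    (hf e (chart_mem_atlas _ q) 0).continuousOn.continuousAt
      ((e.symm.isOpen_inter_preimage hU).mem_nhds
        ⟨e.map_source hqs, by simpa [e.left_inv hqs] using hq⟩)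
  have h2 := ContinuousAt.comp (f := e) h1 (e.continuousAt hqs)
  refine h2.congr ?_
  filter_upwards [e.open_source.mem_nhds hqs] with x hx
  simp [e.left_inv hx]

/-- This is where smoothness of the transition maps enters: `F` is given in one chart, while
`IsGInftyOn` tests every chart of the atlas. -/
theorem isGInftyOn_comp_chart [IsSuperManifold m n M]
    {e : OpenPartialHomeomorph M (SuperSpace m n)}
    (he : e ∈ atlas (SuperSpace m n) M) {F : SuperSpace m n → SuperNumber}
    {W : Set (SuperSpace m n)} (hF : IsGInfty F W) :
    IsGInftyOn m n (fun q => F (e q)) (e.source ∩ e ⁻¹' W) := fun e' he' r => by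
  refine IsG.comp (φ := fun x => e (e'.symm x)) (W := W) (fun x hx => hx.2.2) (fun k => ?_) (hF r)
  refine (IsSuperManifold.compatible e' he' e he k r).mono fun x hx => ?_
  rw [OpenPartialHomeomorph.trans_source]
  exact ⟨hx.1, hx.2.1⟩

theorem isGInftyOn_coord [IsSuperManifold m n M]
    {e : OpenPartialHomeomorph M (SuperSpace m n)}
    (he : e ∈ atlas (SuperSpace m n) M) (k : Fin m ⊕ Fin n) :
    IsGInftyOn m n (fun q => (e q k : SuperNumber)) e.source := by
  simpa using isGInftyOn_comp_chart he (W := Set.univ) fun r => isG_coord k _ r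

/-! ## Coordinate derivations -/

/-- The germ at `q` of a function of class `G^∞` near `q`. -/
def germMk {f : M → SuperNumber} {q : M} (hf : IsGInftyAt m n f q) : SmoothGerm m n q :=
  ⟨(f : Germ (𝓝 q) SuperNumber), f, hf, rfl⟩

theorem exists_eq_germMk {q : M} (F : SmoothGerm m n q) :
    ∃ (f : M → SuperNumber) (hf : IsGInftyAt m n f q), F = germMk hf := by
  obtain ⟨_, f, hf, rfl⟩ := F
  exact ⟨f, hf, rfl⟩

theorem IsGInftyAt.hasSuperDerivAt {f : M → SuperNumber} {q : M} (hf : IsGInftyAt m n f q)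
    {e : OpenPartialHomeomorph M (SuperSpace m n)} (he : e ∈ atlas (SuperSpace m n) M)
    (hq : q ∈ e.source) :
    HasSuperDerivAt (fun x => f (e.symm x))
      (fun k => superDeriv k (fun x => f (e.symm x)) (e q)) (e q) := by
  obtain ⟨U, hU, hqU, h⟩ := hf
  exact (h e he 1).hasSuperDerivAt ⟨e.map_source hq, by simpa [e.left_inv hq] using hqU⟩

/-- The derivation `∂/∂x^k` at `q` for the coordinates of the chart `e`. -/
def coordDeriv (e : OpenPartialHomeomorph M (SuperSpace m n)) (k : Fin m ⊕ Fin n) (q : M)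
    (F : SmoothGerm m n q) : SuperNumber :=
  superDeriv k (fun x => F.2.choose (e.symm x)) (e q)

section CoordDeriv

variable {e : OpenPartialHomeomorph M (SuperSpace m n)} {q : M}

/-- `coordDeriv` is computed on a chosen representative; the choice does not matter because
`superDeriv` depends only on the germ. -/
theorem coordDeriv_germMk (hq : q ∈ e.source) (k : Fin m ⊕ Fin n) {f : M → SuperNumber}
    (hf : IsGInftyAt m n f q) :
    coordDeriv e k q (germMk hf) = superDeriv k (fun x => f (e.symm x)) (e q) := by
  refine superDeriv_congr ?_ k
  exact (e.tendsto_symm hq).eventually (Germ.coe_eq.1 (germMk hf).2.choose_spec.2)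

theorem coordDeriv_eq (hq : q ∈ e.source)
    (k : Fin m ⊕ Fin n) {f : M → SuperNumber} (hf : IsGInftyAt m n f q)
    {f' : Fin m ⊕ Fin n → SuperNumber}
    (h : HasSuperDerivAt (fun x => f (e.symm x)) f' (e q)) :
    coordDeriv e k q (germMk hf) = f' k := by
  rw [coordDeriv_germMk hq, h.superDeriv_eq]

theorem isHomogeneousVector_coordDeriv (he : e ∈ atlas (SuperSpace m n) M) (hq : q ∈ e.source)
    (k : Fin m ⊕ Fin n) : IsHomogeneousVector m n q (parity k) (coordDeriv e k q) where
  map_add F G := by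
    obtain ⟨f, hf, rfl⟩ := exists_eq_germMk F
    obtain ⟨g, hg, rfl⟩ := exists_eq_germMk G
    have hfg := hf.map₂ (· + ·) (fun _ _ _ _ h1 h2 => h1.add h2) hg
    rw [show germMk hf + germMk hg = germMk hfg from rfl, coordDeriv_germMk hq,
      coordDeriv_germMk hq, coordDeriv_germMk hq]
    exact ((hf.hasSuperDerivAt he hq).add (hg.hasSuperDerivAt he hq)).superDeriv_eq k
  map_const_mul b c hc F := by
    obtain ⟨f, hf, rfl⟩ := exists_eq_germMk F
    have hfg := (isGInftyAt_const m n c q).map₂ (· * ·) (fun _ _ _ _ h1 h2 => h1.mul h2) hf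
    rw [show constGerm m n q c * germMk hf = germMk hfg from rfl, coordDeriv_germMk hq,
      coordDeriv_germMk hq]
    have h := ((hasSuperDerivAt_const c (e q)).mul (hf.hasSuperDerivAt he hq) hc).superDeriv_eq k
    simpa using h
  leibniz b F G hF := by
    obtain ⟨f, hf, rfl⟩ := exists_eq_germMk F
    obtain ⟨g, hg, rfl⟩ := exists_eq_germMk G
    have hfg := hf.map₂ (· * ·) (fun _ _ _ _ h1 h2 => h1.mul h2) hg
    have hb : f q ∈ part b := (Germ.liftPred_coe.1 hF).self_of_nhds
    rw [show germMk hf * germMk hg = germMk hfg from rfl, coordDeriv_germMk hq,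
      coordDeriv_germMk hq, coordDeriv_germMk hq]
    have h := ((hf.hasSuperDerivAt he hq).mul (hg.hasSuperDerivAt he hq) (b := b)
      (by rwa [e.left_inv hq])).superDeriv_eq k
    simp only [e.left_inv hq] at h
    exact h
  map_parity b F hF := by
    obtain ⟨f, hf, rfl⟩ := exists_eq_germMk F
    rw [coordDeriv_germMk hq]
    exact (hf.hasSuperDerivAt he hq).mem_part
      ((e.tendsto_symm hq).eventually (Germ.liftPred_coe.1 hF)) k

end CoordDeriv

/-! ## Tangent vectors -/

/-- Leibniz applied to `1 * 1` gives `X 1 = X 1 + X 1`. Graded linearity then handles homogeneous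
constants, and every constant is a sum of two of these. -/
theorem IsHomogeneousVector.map_const {p : M} {a : ZMod 2} {X : SmoothGerm m n p → SuperNumber}
    (hX : IsHomogeneousVector m n p a X) (c : SuperNumber) : X (constGerm m n p c) = 0 := by
  have h1 : X 1 = 0 := by
    have h := hX.leibniz 0 1 1 (Germ.liftPred_coe.2 (Eventually.of_forall fun _ => one_mem_part))
    rw [koszul_zero_right, one_smul, mul_one,
      show ((1 : SmoothGerm m n p) : Germ (𝓝 p) SuperNumber).value = 1 from rfl, mul_one, one_mul]
      at h
    simpa using h
  have h2 : ∀ b, ∀ c ∈ part b, X (constGerm m n p c) = 0 := fun b c hc => by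
    have h := hX.map_const_mul b c hc 1
    rwa [mul_one, h1, mul_zero, smul_zero] at h
  have h3 : constGerm m n p c
      = constGerm m n p (proj 0 c : SuperNumber) + constGerm m n p (proj 1 c : SuperNumber) := by
    conv_lhs => rw [← proj_add_proj c]
    rfl
  rw [h3, hX.map_add, h2 0 _ (proj 0 c).2, h2 1 _ (proj 1 c).2, add_zero]

section Expansion

variable {e : OpenPartialHomeomorph M (SuperSpace m n)} {q : M}

/-- The germ at `q` of the `k`-th coordinate of the chart `e`. -/
def coordGerm [IsSuperManifold m n M] (he : e ∈ atlas (SuperSpace m n) M) (hq : q ∈ e.source) (k : Fin m ⊕ Fin n) :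
    SmoothGerm m n q :=
  germMk ((isGInftyOn_coord he k).isGInftyAt e.open_source hq)

theorem coordDeriv_coordGerm [IsSuperManifold m n M]
    (he : e ∈ atlas (SuperSpace m n) M) (hq : q ∈ e.source)
    (j k : Fin m ⊕ Fin n) :
    coordDeriv e j q (coordGerm he hq k) = (Pi.single k 1 : _ → SuperNumber) j := by
  refine coordDeriv_eq hq j _ ((hasSuperDerivAt_coord k (e q)).congr_of_eventuallyEq ?_)
  filter_upwards [e.open_target.mem_nhds (e.map_source hq)] with x hx
  rw [e.right_inv hx]

/-- Hadamard's lemma writes the germ as a constant plus `∑ (x^k - x^k(q)) Φ_k`. A derivation kills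
the constant, and the Leibniz terms containing `X Φ_k` carry the factor `x^k - x^k(q)` evaluated at
`q`, which is zero. The coefficients `c k = Φ_k(q)` do not depend on `X`, so the formula passes to
sums of vectors of different parity. -/
theorem exists_value_expansion [IsSuperManifold m n M]
    (he : e ∈ atlas (SuperSpace m n) M) (hq : q ∈ e.source)
    (F : SmoothGerm m n q) : ∃ c : Fin m ⊕ Fin n → SuperNumber,
      ∀ a X, IsHomogeneousVector m n q a X → X F = ∑ k, X (coordGerm he hq k) * c k := by
  obtain ⟨f, ⟨U, hU, hqU, hf⟩, rfl⟩ := exists_eq_germMk F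
  have hopen := e.symm.isOpen_inter_preimage hU
  obtain ⟨ρ, hρ, hball⟩ := Metric.isOpen_iff.1 hopen (e q)
    ⟨e.map_source hq, by simpa [e.left_inv hq] using hqU⟩
  have hB : IsGInfty (fun x => f (e.symm x)) (Metric.ball (e q) ρ) :=
    fun r => (hf e he r).mono hball
  obtain ⟨Φ, hΦ, hexp⟩ := hB.hadamard
  have hN : IsOpen (e.source ∩ e ⁻¹' Metric.ball (e q) ρ) :=
    e.isOpen_inter_preimage Metric.isOpen_ball
  have hqN : q ∈ e.source ∩ e ⁻¹' Metric.ball (e q) ρ := ⟨hq, Metric.mem_ball_self hρ⟩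
  have hG : ∀ k, IsGInftyAt m n (fun x => Φ k (e x)) q := fun k =>
    (isGInftyOn_comp_chart he (hΦ k)).isGInftyAt hN hqN
  have hgerm : germMk ⟨U, hU, hqU, hf⟩ = constGerm m n q (f q)
      + ∑ k, (coordGerm he hq k - constGerm m n q (e q k)) * germMk (hG k) := by
    refine Subtype.ext ?_
    have h1 : ((∑ k, (coordGerm he hq k - constGerm m n q (e q k)) * germMk (hG k) :
          SmoothGerm m n q) : Germ (𝓝 q) SuperNumber)
        = ((fun x => ∑ k, ((e x k : SuperNumber) - e q k) * Φ k (e x) : M → SuperNumber) :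
          Germ (𝓝 q) SuperNumber) := by
      rw [AddSubmonoidClass.coe_finsetSum]
      have h2 := map_sum (Germ.coeAddHom (M := SuperNumber) (𝓝 q))
        (fun k x => ((e x k : SuperNumber) - e q k) * Φ k (e x)) Finset.univ
      rw [Finset.sum_fn] at h2
      exact h2.symm
    rw [Subring.coe_add, h1]
    refine Germ.coe_eq.2 ?_
    filter_upwards [hN.mem_nhds hqN] with x hx
    have := hexp (e x) hx.2
    rwa [e.left_inv hx.1, e.left_inv hq] at this
  refine ⟨fun k => Φ k (e q), fun a X hX => ?_⟩
  rw [hgerm, hX.map_add, hX.map_const, zero_add]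
  have hsum := map_sum (AddMonoidHom.mk' X hX.map_add)
    (fun k => (coordGerm he hq k - constGerm m n q (e q k)) * germMk (hG k)) Finset.univ
  simp only [AddMonoidHom.mk'_apply] at hsum
  rw [hsum]
  refine Finset.sum_congr rfl fun k _ => ?_
  have hpar : ((coordGerm he hq k - constGerm m n q (e q k) : SmoothGerm m n q) :
      Germ (𝓝 q) SuperNumber).LiftPred (· ∈ part (parity k)) :=
    Germ.liftPred_coe.2 (Eventually.of_forall fun x => sub_mem (e x k).2 (e q k).2)
  rw [hX.leibniz _ _ _ hpar]
  have hval : ((coordGerm he hq k - constGerm m n q (e q k) : SmoothGerm m n q) :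
      Germ (𝓝 q) SuperNumber).value = 0 := sub_self (e q k : SuperNumber)
  have hsub := map_sub (AddMonoidHom.mk' X hX.map_add) (coordGerm he hq k)
    (constGerm m n q (e q k))
  simp only [AddMonoidHom.mk'_apply] at hsub
  rw [hval, zero_mul, smul_zero, add_zero, hsub, hX.map_const, sub_zero]
  rfl

theorem tangent_apply_eq [IsSuperManifold m n M]
    (he : e ∈ atlas (SuperSpace m n) M) (hq : q ∈ e.source)
    (X : SuperTangent m n q) (F : SmoothGerm m n q) :
    X.1 F = ∑ k, X.1 (coordGerm he hq k) * coordDeriv e k q F := by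
  obtain ⟨c, hc⟩ := exists_value_expansion he hq F
  -- Testing the universal expansion on the coordinate derivations, which are dual to the
  -- coordinates, identifies its coefficients as partial derivatives.
  have hk : ∀ k, coordDeriv e k q F = c k := fun k => by
    rw [hc _ _ (isHomogeneousVector_coordDeriv he hq k)]
    simp only [coordDeriv_coordGerm]
    rw [Finset.sum_eq_single k]
    · simp
    · intro j _ hj
      simp [Pi.single_eq_of_ne' hj]
    · simp
  simp only [hk]
  refine Submodule.span_induction (p := fun X _ => X F = ∑ k, X (coordGerm he hq k) * c k)
    ?_ ?_ ?_ ?_ X.2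
  · rintro X ⟨a, hX⟩
    exact hc a X hX
  · simp
  · intro X Y _ _ hX hY
    simp only [Pi.add_apply, hX, hY, add_mul, Finset.sum_add_distrib]
  · intro a X _ hX
    simp only [Pi.smul_apply, smul_eq_mul, hX, Finset.mul_sum, mul_assoc]

open Classical in
/-- The coordinate vector field `∂/∂x^k` of the chart `e`. -/
def coordField (e : OpenPartialHomeomorph M (SuperSpace m n)) (k : Fin m ⊕ Fin n) (q : M) :
    SuperTangent m n q :=
  -- Outside the source of the chart `coordDeriv` need not be tangent; the zero there is only a
  -- default.
  if h : coordDeriv e k q ∈ SuperTangent m n q then ⟨coordDeriv e k q, h⟩ else 0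

theorem coe_coordField (he : e ∈ atlas (SuperSpace m n) M) (hq : q ∈ e.source)
    (k : Fin m ⊕ Fin n) :
    (coordField e k q : SmoothGerm m n q → SuperNumber) = coordDeriv e k q := by
  have h : coordDeriv e k q ∈ SuperTangent m n q :=
    Submodule.subset_span ⟨_, isHomogeneousVector_coordDeriv he hq k⟩
  rw [coordField, dif_pos h]

theorem isPure_coordField (he : e ∈ atlas (SuperSpace m n) M) (hq : q ∈ e.source)
    (k : Fin m ⊕ Fin n) : IsPure (parity k) (coordField e k q) := by
  rw [IsPure, coe_coordField he hq]
  exact isHomogeneousVector_coordDeriv he hq k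

theorem tangent_eq_sum [IsSuperManifold m n M]
    (he : e ∈ atlas (SuperSpace m n) M) (hq : q ∈ e.source)
    (X : SuperTangent m n q) : X = ∑ k, X.1 (coordGerm he hq k) • coordField e k q := by
  refine Subtype.ext (funext fun F => ?_)
  rw [tangent_apply_eq he hq X F, AddSubmonoidClass.coe_finsetSum, Finset.sum_apply]
  refine Finset.sum_congr rfl fun k _ => ?_
  rw [Submodule.coe_smul, coe_coordField he hq]
  rfl

theorem span_coordField [IsSuperManifold m n M]
    (he : e ∈ atlas (SuperSpace m n) M) (hq : q ∈ e.source) :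
    Submodule.span SuperNumber (Set.range fun k => coordField (m := m) (n := n) e k q) = ⊤ := by
  refine eq_top_iff.2 fun X _ => ?_
  rw [tangent_eq_sum he hq X]
  exact Submodule.sum_mem _ fun k _ =>
    Submodule.smul_mem _ _ (Submodule.subset_span (Set.mem_range_self k))

theorem isVectorFieldOn_coordField [IsSuperManifold m n M]
    (he : e ∈ atlas (SuperSpace m n) M) (k : Fin m ⊕ Fin n) :
    IsVectorFieldOn (m := m) (n := n) (coordField e k) e.source := by
  intro V hVe hV f hf
  have hopen := e.symm.isOpen_inter_preimage hV
  have hF : IsGInfty (superDeriv k (fun x => f (e.symm x))) (e.target ∩ e.symm ⁻¹' V) :=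
    fun r => (hf e he (r + 1)).superDeriv hopen k
  have h := isGInftyOn_comp_chart he hF
  have hVs : V ⊆ e.source ∩ e ⁻¹' (e.target ∩ e.symm ⁻¹' V) := fun x hx =>
    ⟨hVe hx, e.map_source (hVe hx), by simpa [e.left_inv (hVe hx)] using hx⟩
  refine (h.mono hVs).congr hV fun q hq => ?_
  have hfq : IsGInftyAt m n f q := hf.isGInftyAt hV hq
  rw [applyFun, dif_pos hfq, coe_coordField he (hVe hq)]
  exact coordDeriv_germMk (hVe hq) k hfq

end Expansion

/-! ## Pure vectors and pure vector fields -/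

theorem IsPure.add {p : M} {a : ZMod 2} {X Y : SuperTangent m n p} (hX : IsPure a X)
    (hY : IsPure a Y) : IsPure a (X + Y) where
  map_add F G := by
    simp only [Submodule.coe_add, Pi.add_apply, hX.map_add, hY.map_add]
    abel
  map_const_mul b c hc F := by
    simp only [Submodule.coe_add, Pi.add_apply, hX.map_const_mul b c hc, hY.map_const_mul b c hc,
      mul_add, smul_add]
  leibniz b F G hF := by
    simp only [Submodule.coe_add, Pi.add_apply, hX.leibniz b F G hF, hY.leibniz b F G hF,
      mul_add, add_mul, smul_add]
    abel
  map_parity b F hF := add_mem (hX.map_parity b F hF) (hY.map_parity b F hF)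

theorem IsPure.smul {p : M} {a b : ZMod 2} {c : SuperNumber} (hc : c ∈ part b)
    {X : SuperTangent m n p} (hX : IsPure a X) : IsPure (b + a) (c • X) where
  map_add F G := by
    simp only [Submodule.coe_smul, Pi.smul_apply, hX.map_add, smul_add]
  map_const_mul b' c' hc' F := by
    simp only [Submodule.coe_smul, Pi.smul_apply, hX.map_const_mul b' c' hc', smul_eq_mul]
    rw [mul_smul_comm, ← mul_assoc, mul_comm_of_mem hc hc', smul_mul_assoc, smul_smul, mul_assoc,
      koszul_add_left, mul_comm (koszul a b')]
  leibniz b' F G hF := by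
    have hv : (F : Germ (𝓝 p) SuperNumber).value ∈ part b' := by
      obtain ⟨f, hf, rfl⟩ := exists_eq_germMk F
      exact (Germ.liftPred_coe.1 hF).self_of_nhds
    simp only [Submodule.coe_smul, Pi.smul_apply, hX.leibniz b' F G hF, smul_eq_mul, mul_add]
    rw [← mul_assoc, mul_smul_comm, ← mul_assoc c, mul_comm_of_mem hc hv, smul_mul_assoc,
      smul_smul, mul_assoc, mul_assoc, koszul_add_left, mul_comm (koszul a b')]
  map_parity b' F hF := by
    rw [add_assoc]
    exact mul_mem_part hc (hX.map_parity b' F hF)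

theorem applyFun_add {p : M} (X Y : SuperTangent m n p) (f : M → SuperNumber) :
    applyFun (X + Y) f = applyFun X f + applyFun Y f := by
  unfold applyFun
  split_ifs
  · rfl
  · simp

theorem applyFun_smul {p : M} (c : SuperNumber) (X : SuperTangent m n p) (f : M → SuperNumber) :
    applyFun (c • X) f = c * applyFun X f := by
  unfold applyFun
  split_ifs
  · rfl
  · simp

/-- `c` is a `G^∞` function on `U` of parity `b`. -/
structure IsPureFunOn (b : ZMod 2) (c : M → SuperNumber) (U : Set M) : Prop where
  smooth : IsGInftyOn m n c U
  mem_part : ∀ q ∈ U, c q ∈ part b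

/-- `X` is a super vector field on `U` of parity `a`. -/
structure IsPureFieldOn (a : ZMod 2) (X : ∀ q : M, SuperTangent m n q) (U : Set M) : Prop where
  isVectorFieldOn : IsVectorFieldOn X U
  isPure : ∀ q ∈ U, IsPure a (X q)

theorem IsPureFunOn.mono {b : ZMod 2} {c : M → SuperNumber} {U V : Set M}
    (h : IsPureFunOn (m := m) (n := n) b c U) (hVU : V ⊆ U) :
    IsPureFunOn (m := m) (n := n) b c V :=
  ⟨h.smooth.mono hVU, fun q hq => h.mem_part q (hVU hq)⟩

theorem IsPureFunOn.neg {b : ZMod 2} {c : M → SuperNumber} {U : Set M}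
    (h : IsPureFunOn (m := m) (n := n) b c U) :
    IsPureFunOn (m := m) (n := n) b (fun q => -c q) U :=
  ⟨h.smooth.neg, fun q hq => neg_mem (h.mem_part q hq)⟩

theorem IsPureFunOn.mul {a b : ZMod 2} {c d : M → SuperNumber} {U : Set M}
    (hc : IsPureFunOn (m := m) (n := n) a c U) (hd : IsPureFunOn (m := m) (n := n) b d U) :
    IsPureFunOn (m := m) (n := n) (a + b) (fun q => c q * d q) U :=
  ⟨hc.smooth.mul hd.smooth, fun q hq => mul_mem_part (hc.mem_part q hq) (hd.mem_part q hq)⟩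

/-- The body of `c` is continuous, so it stays nonzero on a neighbourhood; there every value has an
even inverse, and inversion preserves `G^∞`. This is the pivot step of both Gram-Schmidt processes.
-/
theorem IsPureFunOn.exists_inverse {c : M → SuperNumber} {U : Set M} (hU : IsOpen U)
    (hc : IsPureFunOn (m := m) (n := n) 0 c U) {p : M} (hp : p ∈ U) (hb : body (c p) ≠ 0) :
    ∃ V ⊆ U, IsOpen V ∧ p ∈ V ∧ ∃ c', IsPureFunOn (m := m) (n := n) 0 c' V ∧
      ∀ q ∈ V, c q * c' q = 1 ∧ c' q * c q = 1 := by
  have hcont : ContinuousOn (fun q => body (c q)) U :=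
    continuous_body.comp_continuousOn (hc.smooth.continuousOn hU)
  have hinv : ∀ q ∈ U ∩ (fun q => body (c q)) ⁻¹' {0}ᶜ, IsUnit (c q) ∧
      Ring.inverse (c q) ∈ part 0 ∧ c q * Ring.inverse (c q) = 1 ∧
        Ring.inverse (c q) * c q = 1 := by
    intro q hq
    obtain ⟨y, hy0, h1, h2⟩ := exists_even_inverse (hc.mem_part q hq.1) hq.2
    have h3 : Ring.inverse (c q) = y := Ring.inverse_unit ⟨c q, y, h1, h2⟩
    rw [h3]
    exact ⟨⟨⟨c q, y, h1, h2⟩, rfl⟩, hy0, h1, h2⟩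
  refine ⟨_, Set.inter_subset_left, hcont.isOpen_inter_preimage hU isOpen_compl_singleton, ⟨hp, hb⟩,
    fun q => Ring.inverse (c q), ⟨?_, fun q hq => (hinv q hq).2.1⟩, fun q hq => (hinv q hq).2.2⟩
  exact (hc.smooth.mono Set.inter_subset_left).ringInverse
    fun q hq => ⟨(hinv q hq).1, (hinv q hq).2.1⟩

theorem IsPureFieldOn.mono {a : ZMod 2} {X : ∀ q : M, SuperTangent m n q} {U V : Set M}
    (h : IsPureFieldOn a X U) (hVU : V ⊆ U) : IsPureFieldOn a X V :=
  ⟨fun W hW => h.isVectorFieldOn W (hW.trans hVU), fun q hq => h.isPure q (hVU hq)⟩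

theorem IsPureFieldOn.add {a : ZMod 2} {X Y : ∀ q : M, SuperTangent m n q} {U : Set M}
    (hX : IsPureFieldOn a X U) (hY : IsPureFieldOn a Y U) :
    IsPureFieldOn a (fun q => X q + Y q) U where
  isVectorFieldOn V hVU hV f hf := by
    simp only [applyFun_add]
    exact (hX.isVectorFieldOn V hVU hV f hf).add (hY.isVectorFieldOn V hVU hV f hf)
  isPure q hq := (hX.isPure q hq).add (hY.isPure q hq)

theorem IsPureFieldOn.smul {a b : ZMod 2} {c : M → SuperNumber} {X : ∀ q : M, SuperTangent m n q}
    {U : Set M} (hc : IsPureFunOn (m := m) (n := n) b c U) (hX : IsPureFieldOn a X U) :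
    IsPureFieldOn (b + a) (fun q => c q • X q) U where
  isVectorFieldOn V hVU hV f hf := by
    simp only [applyFun_smul]
    exact (hc.smooth.mono hVU).mul (hX.isVectorFieldOn V hVU hV f hf)
  isPure q hq := (hX.isPure q hq).smul (hc.mem_part q hq)

theorem IsPureFieldOn.add_sum {ι : Type*} (s : Finset ι) {a : ZMod 2} {U : Set M}
    {X : ∀ q : M, SuperTangent m n q} {Y : ι → ∀ q : M, SuperTangent m n q}
    (hX : IsPureFieldOn a X U) (hY : ∀ i ∈ s, IsPureFieldOn a (Y i) U) :
    IsPureFieldOn a (fun q => X q + ∑ i ∈ s, Y i q) U := by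
  classical
  induction s using Finset.induction_on with
  | empty => simpa using hX
  | insert i s hi ih =>
    have h := (ih fun j hj => hY j (Finset.mem_insert_of_mem hj)).add
      (hY i (Finset.mem_insert_self i s))
    simp only [Finset.sum_insert hi]
    convert h using 2 with q
    rw [add_assoc, add_comm (Y i q)]

/-! ## Algebra of a super Riemannian metric -/

namespace SuperRiemannianMetric

variable (g : SuperRiemannianMetric m n M) {q : M}

/-- The left linear functional `g(·, z)`. -/
def left (q : M) (z : SuperTangent m n q) : SuperTangent m n q →ₗ[SuperNumber] SuperNumber where
  toFun x := g.val q x z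
  map_add' x y := by simpa using g.linear_left q 1 1 x y z
  map_smul' c x := by simpa using g.linear_left q c 0 x 0 z

theorem val_add_left (x y z : SuperTangent m n q) :
    g.val q (x + y) z = g.val q x z + g.val q y z := (g.left q z).map_add x y

theorem val_smul_left (c : SuperNumber) (x z : SuperTangent m n q) :
    g.val q (c • x) z = c * g.val q x z := (g.left q z).map_smul c x

theorem val_sum_left {ι : Type*} (s : Finset ι) (x : ι → SuperTangent m n q)
    (z : SuperTangent m n q) : g.val q (∑ i ∈ s, x i) z = ∑ i ∈ s, g.val q (x i) z :=
  map_sum (g.left q z) x s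

theorem val_sum_right {ι : Type*} (s : Finset ι) (x : ι → SuperTangent m n q)
    (z : SuperTangent m n q) : g.val q z (∑ i ∈ s, x i) = ∑ i ∈ s, g.val q z (x i) :=
  map_sum (AddMonoidHom.mk' (g.val q z) (g.add_right q z)) x s

theorem val_eq_zero_comm {a b : ZMod 2} {x y : SuperTangent m n q} (hx : IsPure a x)
    (hy : IsPure b y) (h : g.val q x y = 0) : g.val q y x = 0 := by
  rw [g.symm q b a y x hy hx, h, smul_zero]

theorem val_eq_zero_of_mem_span {S : Set (SuperTangent m n q)} {z : SuperTangent m n q}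
    (h : ∀ x ∈ S, g.val q x z = 0) {x : SuperTangent m n q}
    (hx : x ∈ Submodule.span SuperNumber S) : g.val q x z = 0 :=
  (Submodule.span_le (p := LinearMap.ker (g.left q z))).2 h hx

theorem val_smul_right_eq_zero {a b c : ZMod 2} {x y : SuperTangent m n q} (hx : IsPure a x)
    (hy : IsPure b y) (h : g.val q x y = 0) {r : SuperNumber} (hr : r ∈ part c) :
    g.val q x (r • y) = 0 := by
  refine g.val_eq_zero_comm (hy.smul hr) hx ?_
  rw [g.val_smul_left, g.val_eq_zero_comm hx hy h, mul_zero]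

/-- The metric is linear only on the left. Taking a scalar out on the right uses graded symmetry
twice and leaves a sign that depends on the parity of the scalar; the sign matters only for odd
scalars, whose body is zero. -/
theorem body_val_smul_right {a b : ZMod 2} {x y : SuperTangent m n q} (hx : IsPure a x)
    (hy : IsPure b y) (c : SuperNumber) :
    body (g.val q x (c • y)) = body c * body (g.val q x y) := by
  have h : ∀ i, ∀ r ∈ part i, body (g.val q x (r • y)) = body r * body (g.val q x y) := by
    intro i r hr
    rw [g.symm q a (i + b) x _ hx (hy.smul hr), g.val_smul_left, body_smul, map_mul,
      g.symm q a b x y hx hy, body_smul, koszul_add_right]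
    rcases zmod_two_cases i with rfl | rfl
    · rw [koszul_zero_right]
      ring
    · rw [body_of_odd hr]
      ring
  conv_lhs => rw [← proj_add_proj c, add_smul, g.add_right, map_add, h 0 _ (proj 0 c).2,
    h 1 _ (proj 1 c).2, body_of_odd (proj 1 c).2, zero_mul, add_zero, body_proj_zero]

theorem isPureFunOn_val {a b : ZMod 2} {X Y : ∀ q : M, SuperTangent m n q} {U : Set M}
    (hU : IsOpen U) (hX : IsPureFieldOn a X U) (hY : IsPureFieldOn b Y U) :
    IsPureFunOn (m := m) (n := n) (a + b) (fun q => g.val q (X q) (Y q)) U :=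
  ⟨g.smooth U hU X Y hX.isVectorFieldOn hY.isVectorFieldOn,
    fun q hq => g.even q a b _ _ (hX.isPure q hq) (hY.isPure q hq)⟩

/-- The body of the Gram matrix at `p` of a family of vector fields. -/
def bodyGram {ι : Type*} (p : M) (x : ι → ∀ q : M, SuperTangent m n q) : Matrix ι ι ℝ :=
  Matrix.of fun i j => body (g.val p (x i p) (x j p))

theorem bodyGram_apply {ι : Type*} (p : M) (x : ι → ∀ q : M, SuperTangent m n q) (i j : ι) :
    g.bodyGram p x i j = body (g.val p (x i p) (x j p)) := rfl

end SuperRiemannianMetric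

/-! ## Linear algebra -/

theorem det_ne_zero_iff_vecMul {k : ℕ} {B : Matrix (Fin k) (Fin k) ℝ} :
    B.det ≠ 0 ↔ ∀ c : Fin k → ℝ, (∀ l, ∑ i, c i * B i l = 0) → c = 0 := by
  rw [ne_eq, ← Matrix.exists_vecMul_eq_zero_iff]
  push Not
  refine forall_congr' fun c => ?_
  rw [not_imp_not]
  refine imp_congr_left ?_
  rw [funext_iff]
  rfl

/-- A Schur complement with respect to the first index. -/
theorem det_reduce_one_ne_zero {k : ℕ} {B : Matrix (Fin (k + 1)) (Fin (k + 1)) ℝ} (hB : B.det ≠ 0)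
    (a : Fin k → ℝ) (h0 : ∀ j, B j.succ 0 + a j * B 0 0 = 0) :
    (Matrix.of fun j l : Fin k => B j.succ l.succ + a j * B 0 l.succ).det ≠ 0 := by
  rw [det_ne_zero_iff_vecMul] at hB ⊢
  intro c hc
  -- A relation among the rows of the reduced matrix lifts to one among the rows of `B`, the pivot
  -- row receiving the coefficient `∑ c_j a_j`.
  have key : ∀ l, ∑ i, (Fin.cons (∑ j, c j * a j) c : Fin (k + 1) → ℝ) i * B i l
      = ∑ j, c j * (B j.succ l + a j * B 0 l) := by
    intro l
    rw [Fin.sum_univ_succ]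
    simp only [Fin.cons_zero, Fin.cons_succ, Finset.sum_mul, ← Finset.sum_add_distrib]
    exact Finset.sum_congr rfl fun j _ => by ring
  have hl : ∀ l, ∑ i, (Fin.cons (∑ j, c j * a j) c : Fin (k + 1) → ℝ) i * B i l = 0 := by
    refine Fin.cases ?_ fun l => ?_
    · rw [key]
      simp [h0]
    · rw [key]
      exact hc l
  funext j
  simpa using congrFun (hB _ hl) j.succ

/-- A Schur complement with respect to the first two indices. -/
theorem det_reduce_two_ne_zero {k : ℕ} {B : Matrix (Fin (k + 2)) (Fin (k + 2)) ℝ} (hB : B.det ≠ 0)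
    (a b : Fin k → ℝ) (h0 : ∀ j, B j.succ.succ 0 + a j * B 0 0 + b j * B 1 0 = 0)
    (h1 : ∀ j, B j.succ.succ 1 + a j * B 0 1 + b j * B 1 1 = 0) :
    (Matrix.of fun j l : Fin k =>
      B j.succ.succ l.succ.succ + a j * B 0 l.succ.succ + b j * B 1 l.succ.succ).det ≠ 0 := by
  rw [det_ne_zero_iff_vecMul] at hB ⊢
  intro c hc
  have key : ∀ l, ∑ i, (Fin.cons (∑ j, c j * a j) (Fin.cons (∑ j, c j * b j) c) :
      Fin (k + 2) → ℝ) i * B i l = ∑ j, c j * (B j.succ.succ l + a j * B 0 l + b j * B 1 l) := by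
    intro l
    rw [Fin.sum_univ_succ, Fin.sum_univ_succ]
    simp only [Fin.cons_zero, Fin.cons_succ]
    simp only [Fin.succ_zero_eq_one, Finset.sum_mul, ← Finset.sum_add_distrib]
    exact Finset.sum_congr rfl fun j _ => by ring
  have hl : ∀ l, ∑ i, (Fin.cons (∑ j, c j * a j) (Fin.cons (∑ j, c j * b j) c) :
      Fin (k + 2) → ℝ) i * B i l = 0 := by
    refine Fin.cases ?_ (Fin.cases ?_ fun l => ?_)
    · rw [key]
      simp only [h0, mul_zero, Finset.sum_const_zero]
    · rw [key]
      simp only [Fin.succ_zero_eq_one, h1, mul_zero, Finset.sum_const_zero]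
    · rw [key]
      exact hc l
  funext j
  simpa using congrFun (hB _ hl) j.succ.succ

theorem span_sup_span_range_congr {R V ι : Type*} [Ring R] [AddCommGroup V] [Module R V]
    {W : Submodule R V} {y z : ι → V} (h : ∀ j, z j - y j ∈ W) :
    W ⊔ Submodule.span R (Set.range z) = W ⊔ Submodule.span R (Set.range y) := by
  have key : ∀ {y z : ι → V}, (∀ j, z j - y j ∈ W) →
      W ⊔ Submodule.span R (Set.range z) ≤ W ⊔ Submodule.span R (Set.range y) := by
    intro y z h
    refine sup_le le_sup_left (Submodule.span_le.2 ?_)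
    rintro _ ⟨j, rfl⟩
    have h1 : z j = (z j - y j) + y j := by abel
    rw [h1]
    exact add_mem (Submodule.mem_sup_left (h j))
      (Submodule.mem_sup_right (Submodule.subset_span ⟨j, rfl⟩))
  exact le_antisymm (key h) (key fun j => by rw [← neg_sub]; exact neg_mem (h j))

theorem span_range_update_add {R V ι : Type*} [DecidableEq ι] [Ring R] [AddCommGroup V] [Module R V]
    (x : ι → V) {i j : ι} (hij : i ≠ j) :
    Submodule.span R (Set.range (Function.update x i (x i + x j)))
      = Submodule.span R (Set.range x) := by
  refine le_antisymm (Submodule.span_le.2 ?_) (Submodule.span_le.2 ?_)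
  · rintro _ ⟨l, rfl⟩
    by_cases hl : l = i
    · subst hl
      rw [Function.update_self]
      exact add_mem (Submodule.subset_span ⟨l, rfl⟩) (Submodule.subset_span ⟨j, rfl⟩)
    · rw [Function.update_of_ne hl]
      exact Submodule.subset_span ⟨l, rfl⟩
  · rintro _ ⟨l, rfl⟩
    have hmem : ∀ l, Function.update x i (x i + x j) l
        ∈ Submodule.span R (Set.range (Function.update x i (x i + x j))) :=
      fun l => Submodule.subset_span ⟨l, rfl⟩
    by_cases hl : l = i
    · subst hl
      have h := sub_mem (hmem l) (hmem j)
      rwa [Function.update_self, Function.update_of_ne hij.symm, add_sub_cancel_right] at h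
    · have h := hmem l
      rwa [Function.update_of_ne hl] at h

/-! ## The standard symplectic matrix -/

section BlockJ

variable {k : ℕ}

theorem blockJ_succ_succ (i j : Fin k) :
    blockJ (k + 2) i.succ.succ j.succ.succ = blockJ k i j := by
  simp [blockJ, Nat.even_add_one]

theorem blockJ_zero_zero : blockJ (k + 2) 0 0 = 0 := by simp [blockJ]

theorem blockJ_zero_one : blockJ (k + 2) 0 1 = 1 := by simp [blockJ]

theorem blockJ_one_zero : blockJ (k + 2) 1 0 = -1 := by simp [blockJ]

theorem blockJ_one_one : blockJ (k + 2) 1 1 = 0 := by simp [blockJ]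

theorem blockJ_zero_succ_succ (j : Fin k) : blockJ (k + 2) 0 j.succ.succ = 0 := by simp [blockJ]

theorem blockJ_one_succ_succ (j : Fin k) : blockJ (k + 2) 1 j.succ.succ = 0 := by simp [blockJ]

theorem blockJ_succ_succ_zero (j : Fin k) : blockJ (k + 2) j.succ.succ 0 = 0 := by simp [blockJ]

theorem blockJ_succ_succ_one (j : Fin k) : blockJ (k + 2) j.succ.succ 1 = 0 := by simp [blockJ]

/-- Nondegeneracy of the symplectic block, by peeling off two coordinates at a time. Evenness is
needed: for odd `k` the last row of `blockJ k` is zero. -/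
theorem eq_zero_of_vecMul_blockJ : ∀ {k : ℕ} (_ : Even k) {c : Fin k → SuperNumber}
    (_ : ∀ j, ∑ i, c i * blockJ k i j = 0), c = 0
  | 0, _, _, _ => Subsingleton.elim _ _
  | 1, h1, _, _ => absurd h1 (by decide)
  | k + 2, hk, c, h => by
    simp only [Fin.sum_univ_succ, Fin.succ_zero_eq_one] at h
    have h0 := h 0
    have h1 := h 1
    have h2 := fun j : Fin k => h j.succ.succ
    simp only [blockJ_zero_zero, blockJ_one_zero, blockJ_succ_succ_zero, mul_zero, mul_neg,
      mul_one, Finset.sum_const_zero, add_zero, zero_add, neg_eq_zero] at h0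
    simp only [blockJ_zero_one, blockJ_one_one, blockJ_succ_succ_one, mul_zero,
      mul_one, Finset.sum_const_zero, add_zero] at h1
    simp only [blockJ_zero_succ_succ, blockJ_one_succ_succ, blockJ_succ_succ, mul_zero,
      zero_add] at h2
    have h3 := eq_zero_of_vecMul_blockJ ((Nat.even_add.1 hk).2 even_two) h2
    funext i
    refine Fin.cases ?_ (Fin.cases ?_ fun i => ?_) i
    · exact h1
    · exact h0
    · exact congrFun h3 i

end BlockJ

theorem span_range_fin_succ {R V : Type*} [Ring R] [AddCommGroup V] [Module R V] {k : ℕ}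
    (f : Fin (k + 1) → V) : Submodule.span R (Set.range f)
      = Submodule.span R {f 0} ⊔ Submodule.span R (Set.range fun i : Fin k => f i.succ) := by
  rw [Fin.range_fin_succ, Submodule.span_insert]
  rfl

namespace SuperRiemannianMetric

variable (g : SuperRiemannianMetric m n M) {p : M} {U : Set M}

/-! ## Gram-Schmidt process for even vector fields -/

/-- Polarization: if all diagonal bodies vanish but the entry at `(i, j)` does not, replacing `x i`
by `x i + x j` produces twice that entry on the diagonal. -/
theorem exists_even_diagonal_ne_zero (hp : p ∈ U) {k : ℕ}
    {x : Fin (k + 1) → ∀ q : M, SuperTangent m n q} (hx : ∀ i, IsPureFieldOn 0 (x i) U)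
    (hdet : (g.bodyGram p x).det ≠ 0) :
    ∃ y : Fin (k + 1) → ∀ q : M, SuperTangent m n q, (∀ i, IsPureFieldOn 0 (y i) U) ∧
      (g.bodyGram p y).det ≠ 0 ∧
      (∀ q, Submodule.span SuperNumber (Set.range fun i => y i q)
        = Submodule.span SuperNumber (Set.range fun i => x i q)) ∧
      ∃ i, g.bodyGram p y i i ≠ 0 := by
  by_cases hd : ∃ i, g.bodyGram p x i i ≠ 0
  · exact ⟨x, hx, hdet, fun _ => rfl, hd⟩
  push Not at hd
  have hne : ∃ i j, g.bodyGram p x i j ≠ 0 := by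
    by_contra! h
    exact hdet (Matrix.det_eq_zero_of_row_eq_zero 0 (h 0))
  obtain ⟨i, j, hij⟩ := hne
  have hneq : i ≠ j := by
    rintro rfl
    exact hij (hd i)
  have hsymm : ∀ l l', g.bodyGram p x l l' = g.bodyGram p x l' l := fun l l' => by
    rw [bodyGram_apply, g.symm p 0 0 _ _ ((hx l).isPure p hp) ((hx l').isPure p hp),
      koszul_zero_left, one_smul]
    rfl
  let y : Fin (k + 1) → ∀ q : M, SuperTangent m n q :=
    Function.update x i (fun q => x i q + x j q)
  have hyi : y i = fun q => x i q + x j q := Function.update_self i _ x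
  have hyl : ∀ l, l ≠ i → y l = x l := fun l hl => Function.update_of_ne hl _ x
  have hy : ∀ l, IsPureFieldOn 0 (y l) U := fun l => by
    by_cases hl : l = i
    · rw [hl, hyi]
      exact (hx i).add (hx j)
    · rw [hyl l hl]
      exact hx l
  -- The replacement is a row operation followed by the matching column operation, and neither
  -- changes the determinant.
  have hgram : g.bodyGram p y = Matrix.updateCol
      (Matrix.updateRow (g.bodyGram p x) i (g.bodyGram p x i + g.bodyGram p x j)) i
      (fun l => Matrix.updateRow (g.bodyGram p x) i (g.bodyGram p x i + g.bodyGram p x j) l i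
        + Matrix.updateRow (g.bodyGram p x) i (g.bodyGram p x i + g.bodyGram p x j) l j) := by
    ext l l'
    rw [Matrix.updateCol_apply, Matrix.updateRow_apply, Matrix.updateRow_apply,
      Matrix.updateRow_apply, bodyGram_apply]
    by_cases hl : l = i <;> by_cases hl' : l' = i
    · simp only [hl, hl', hyi, if_true, val_add_left, g.add_right, map_add, Pi.add_apply,
        bodyGram_apply]
    · simp only [hl, hl', hyi, if_true, if_false, hyl l' hl', val_add_left, map_add, Pi.add_apply,
        bodyGram_apply]
    · simp only [hl, hl', hyi, if_true, if_false, hyl l hl, g.add_right, map_add,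
        bodyGram_apply]
    · simp only [hl, hl', if_false, hyl l hl, hyl l' hl', bodyGram_apply]
  refine ⟨y, hy, ?_, fun q => ?_, i, ?_⟩
  · rwa [hgram, Matrix.det_updateCol_add_self _ hneq, Matrix.det_updateRow_add_self _ hneq]
  · rw [← span_range_update_add (fun l => x l q) hneq]
    congr 2
    funext l
    by_cases hl : l = i
    · subst hl
      rw [hyi, Function.update_self]
    · rw [hyl l hl, Function.update_of_ne hl]
  · rw [bodyGram_apply, hyi, val_add_left, g.add_right, g.add_right]
    simp only [map_add, ← bodyGram_apply]
    rw [hd i, hd j, hsymm j i]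
    intro h
    apply hij
    linarith

theorem bodyGram_comp_equiv_det {k : ℕ} (x : Fin k → ∀ q : M, SuperTangent m n q)
    (σ : Equiv.Perm (Fin k)) :
    (g.bodyGram p (fun i => x (σ i))).det = (g.bodyGram p x).det :=
  Matrix.det_submatrix_equiv_self σ (g.bodyGram p x)

theorem span_range_comp_equiv {k : ℕ} (x : Fin k → ∀ q : M, SuperTangent m n q)
    (σ : Equiv.Perm (Fin k)) (q : M) :
    Submodule.span SuperNumber (Set.range fun i => x (σ i) q)
      = Submodule.span SuperNumber (Set.range fun i => x i q) :=
  congrArg _ (σ.surjective.range_comp fun i => x i q)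

theorem exists_even_pivot (hp : p ∈ U) {k : ℕ}
    {x : Fin (k + 1) → ∀ q : M, SuperTangent m n q} (hx : ∀ i, IsPureFieldOn 0 (x i) U)
    (hdet : (g.bodyGram p x).det ≠ 0) :
    ∃ y : Fin (k + 1) → ∀ q : M, SuperTangent m n q, (∀ i, IsPureFieldOn 0 (y i) U) ∧
      (g.bodyGram p y).det ≠ 0 ∧
      (∀ q, Submodule.span SuperNumber (Set.range fun i => y i q)
        = Submodule.span SuperNumber (Set.range fun i => x i q)) ∧
      body (g.val p (y 0 p) (y 0 p)) ≠ 0 := by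
  obtain ⟨y, hy, hydet, hspan, i, hi⟩ := g.exists_even_diagonal_ne_zero hp hx hdet
  refine ⟨fun l => y (Equiv.swap 0 i l), fun l => hy _, ?_, fun q => ?_, ?_⟩
  · rwa [bodyGram_comp_equiv_det]
  · rw [span_range_comp_equiv, hspan]
  · simp only [Equiv.swap_apply_left]
    exact hi

/-- Even vector fields whose Gram matrix is invertible at `p` can be orthogonalized near `p`. -/
theorem exists_even_orthogonal : ∀ (k : ℕ) (U : Set M), IsOpen U → p ∈ U →
    ∀ x : Fin k → ∀ q : M, SuperTangent m n q, (∀ i, IsPureFieldOn 0 (x i) U) →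
    (g.bodyGram p x).det ≠ 0 →
    ∃ V ⊆ U, IsOpen V ∧ p ∈ V ∧ ∃ (w : Fin k → ∀ q : M, SuperTangent m n q)
      (d' : Fin k → M → SuperNumber), (∀ i, IsPureFieldOn 0 (w i) V) ∧
      (∀ i, IsPureFunOn (m := m) (n := n) 0 (d' i) V) ∧ ∀ q ∈ V,
        Submodule.span SuperNumber (Set.range fun i => w i q)
          = Submodule.span SuperNumber (Set.range fun i => x i q) ∧
        (∀ i j, i ≠ j → g.val q (w i q) (w j q) = 0) ∧
        ∀ i, g.val q (w i q) (w i q) * d' i q = 1 ∧ d' i q * g.val q (w i q) (w i q) = 1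
  | 0, U, hU, hp, x, hx, _ => ⟨U, subset_rfl, hU, hp, x, fun _ _ => 0, hx, fun i => i.elim0,
      fun _ _ => ⟨rfl, fun i => i.elim0, fun i => i.elim0⟩⟩
  | k + 1, U, hU, hp, x, hx, hdet => by
    obtain ⟨y, hy, hydet, hyspan, hpivot⟩ := g.exists_even_pivot hp hx hdet
    obtain ⟨V₁, hV₁U, hV₁, hpV₁, c, hc, hcinv⟩ :=
      (show IsPureFunOn (m := m) (n := n) 0 (fun q => g.val q (y 0 q) (y 0 q)) U from
        g.isPureFunOn_val hU (hy 0) (hy 0)).exists_inverse hU hp hpivot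
    replace hy := fun i => (hy i).mono hV₁U
    -- The usual projection coefficient, with `c` the inverse of `g(y 0, y 0)`.
    let a : Fin k → M → SuperNumber := fun j q => -(g.val q (y j.succ q) (y 0 q) * c q)
    have ha : ∀ j, IsPureFunOn (m := m) (n := n) 0 (a j) V₁ := fun j =>
      ((g.isPureFunOn_val hV₁ (hy j.succ) (hy 0)).mul hc).neg
    let z : Fin k → ∀ q : M, SuperTangent m n q := fun j q => y j.succ q + a j q • y 0 q
    have hz : ∀ j, IsPureFieldOn 0 (z j) V₁ := fun j =>
      (hy j.succ).add (IsPureFieldOn.smul (ha j) (hy 0))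
    have horth : ∀ q ∈ V₁, ∀ j, g.val q (z j q) (y 0 q) = 0 := fun q hq j => by
      simp only [z, a]
      rw [val_add_left, val_smul_left, neg_mul, mul_assoc, (hcinv q hq).2, mul_one, add_neg_cancel]
    have hpure : ∀ q ∈ V₁, ∀ i, IsPure 0 (y i q) := fun q hq i => (hy i).isPure q hq
    -- As `z j` is orthogonal to `y 0`, correcting the second argument as well has no effect. The
    -- Gram matrix of `z` is thus the Schur complement in that of `y`.
    have hgram : g.bodyGram p z = Matrix.of fun j l : Fin k =>
        g.bodyGram p y j.succ l.succ + body (a j p) * g.bodyGram p y 0 l.succ := by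
      ext j l
      have h0 : g.val p (z j p) (a l p • y 0 p) = 0 :=
        g.val_smul_right_eq_zero ((hz j).isPure p hpV₁) (hpure p hpV₁ 0) (horth p hpV₁ j)
          ((ha l).mem_part p hpV₁)
      have h1 : g.val p (z j p) (z l p) = g.val p (z j p) (y l.succ p) := by
        change g.val p (z j p) (y l.succ p + a l p • y 0 p) = _
        rw [g.add_right, h0, add_zero]
      rw [bodyGram_apply, h1]
      simp only [z, val_add_left, val_smul_left, map_add, map_mul]
      rfl
    have hzdet : (g.bodyGram p z).det ≠ 0 := by
      rw [hgram]
      refine det_reduce_one_ne_zero hydet _ fun j => ?_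
      have := congrArg body (horth p hpV₁ j)
      rw [bodyGram_apply, bodyGram_apply]
      simpa only [z, val_add_left, val_smul_left, map_add, map_mul, map_zero] using this
    obtain ⟨V, hVV₁, hV, hpV, w, d', hw, hd', hwq⟩ :=
      exists_even_orthogonal k V₁ hV₁ hpV₁ z hz hzdet
    have hw0 : ∀ q ∈ V, ∀ i, g.val q (w i q) (y 0 q) = 0 := fun q hq i => by
      refine g.val_eq_zero_of_mem_span (S := Set.range fun i => z i q) ?_ ?_
      · rintro _ ⟨j, rfl⟩
        exact horth q (hVV₁ hq) j
      · rw [← (hwq q hq).1]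
        exact Submodule.subset_span ⟨i, rfl⟩
    refine ⟨V, hVV₁.trans hV₁U, hV, hpV, Fin.cons (y 0) w, Fin.cons c d', ?_, ?_, fun q hq =>
      ⟨?_, ?_, ?_⟩⟩
    · exact Fin.cases ((hy 0).mono hVV₁) hw
    · exact Fin.cases (hc.mono hVV₁) hd'
    · rw [← hyspan q, span_range_fin_succ, span_range_fin_succ]
      simp only [Fin.cons_zero, Fin.cons_succ]
      rw [(hwq q hq).1]
      refine span_sup_span_range_congr fun j => ?_
      simp only [z, add_sub_cancel_left]
      exact Submodule.smul_mem _ _ (Submodule.mem_span_singleton_self _)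
    · refine Fin.cases (Fin.cases (fun h => absurd rfl h) fun j _ => ?_)
        fun i => Fin.cases (fun _ => ?_) fun j hij => ?_
      · simp only [Fin.cons_zero, Fin.cons_succ]
        exact g.val_eq_zero_comm ((hw j).isPure q hq) (hpure q (hVV₁ hq) 0) (hw0 q hq j)
      · simp only [Fin.cons_zero, Fin.cons_succ]
        exact hw0 q hq i
      · simp only [Fin.cons_succ]
        exact (hwq q hq).2.1 i j fun h => hij (congrArg Fin.succ h)
    · refine Fin.cases ?_ fun i => ?_
      · simp only [Fin.cons_zero]
        exact hcinv q (hVV₁ hq)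
      · simp only [Fin.cons_succ]
        exact (hwq q hq).2.2 i

/-! ## Gram-Schmidt process for odd vector fields -/

theorem val_self_of_odd {q : M} {x : SuperTangent m n q} (hx : IsPure 1 x) : g.val q x x = 0 := by
  have h := g.symm q 1 1 x x hx hx
  rw [koszul_one_one, neg_one_smul] at h
  have h2 : (2 : ℝ) • g.val q x x = 0 := by
    rw [two_smul]
    nth_rewrite 1 [h]
    exact neg_add_cancel _
  exact (smul_eq_zero.1 h2).resolve_left two_ne_zero

theorem val_comm_of_odd {q : M} {x y : SuperTangent m n q} (hx : IsPure 1 x) (hy : IsPure 1 y) :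
    g.val q x y = -g.val q y x := by
  rw [g.symm q 1 1 x y hx hy, koszul_one_one, neg_one_smul]

/-- Odd fields are isotropic, so a nonzero entry in the first row is off the diagonal, and a
transposition brings it to position `(0, 1)`. -/
theorem exists_odd_pivot (hp : p ∈ U) {k : ℕ}
    {x : Fin (k + 2) → ∀ q : M, SuperTangent m n q} (hx : ∀ i, IsPureFieldOn 1 (x i) U)
    (hdet : (g.bodyGram p x).det ≠ 0) :
    ∃ y : Fin (k + 2) → ∀ q : M, SuperTangent m n q, (∀ i, IsPureFieldOn 1 (y i) U) ∧
      (g.bodyGram p y).det ≠ 0 ∧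
      (∀ q, Submodule.span SuperNumber (Set.range fun i => y i q)
        = Submodule.span SuperNumber (Set.range fun i => x i q)) ∧
      body (g.val p (y 0 p) (y 1 p)) ≠ 0 := by
  have hne : ∃ j, g.bodyGram p x 0 j ≠ 0 := by
    by_contra! h
    exact hdet (Matrix.det_eq_zero_of_row_eq_zero 0 h)
  obtain ⟨j, hj⟩ := hne
  have hj0 : 0 ≠ j := by
    rintro rfl
    rw [bodyGram_apply, g.val_self_of_odd ((hx 0).isPure p hp), map_zero] at hj
    exact hj rfl
  refine ⟨fun l => x (Equiv.swap 1 j l), fun l => hx _, ?_, fun q => ?_, ?_⟩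
  · rwa [bodyGram_comp_equiv_det]
  · rw [span_range_comp_equiv]
  · simp only [Equiv.swap_apply_left]
    rw [Equiv.swap_apply_of_ne_of_ne (by simp) hj0]
    exact hj

theorem one_add_one_zmod_two : (1 + 1 : ZMod 2) = 0 := by decide

/-- Odd vector fields whose Gram matrix is invertible at `p` can be brought to symplectic form
near `p`. -/
theorem exists_odd_symplectic : ∀ (k : ℕ) (U : Set M), IsOpen U → p ∈ U →
    ∀ x : Fin k → ∀ q : M, SuperTangent m n q, (∀ i, IsPureFieldOn 1 (x i) U) →
    (g.bodyGram p x).det ≠ 0 →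
    Even k ∧ ∃ V ⊆ U, IsOpen V ∧ p ∈ V ∧ ∃ w : Fin k → ∀ q : M, SuperTangent m n q,
      (∀ i, IsPureFieldOn 1 (w i) V) ∧ ∀ q ∈ V,
        Submodule.span SuperNumber (Set.range fun i => w i q)
          = Submodule.span SuperNumber (Set.range fun i => x i q) ∧
        ∀ i j, g.val q (w i q) (w j q) = blockJ k i j
  | 0, U, hU, hp, x, hx, _ => ⟨Even.zero, U, subset_rfl, hU, hp, x, hx,
      fun _ _ => ⟨rfl, fun i => i.elim0⟩⟩
  -- The source of the parity of `n`: one isotropic odd field has a zero `1 × 1` Gram matrix.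
  | 1, U, hU, hp, x, hx, hdet => by
    refine absurd ?_ hdet
    rw [Matrix.det_fin_one, bodyGram_apply, g.val_self_of_odd ((hx 0).isPure p hp), map_zero]
  | k + 2, U, hU, hp, x, hx, hdet => by
    obtain ⟨y, hy, hydet, hyspan, hpivot⟩ := g.exists_odd_pivot hp hx hdet
    have hfun : ∀ {X Y : ∀ q : M, SuperTangent m n q} {W : Set M}, IsOpen W →
        IsPureFieldOn 1 X W → IsPureFieldOn 1 Y W →
        IsPureFunOn (m := m) (n := n) 0 (fun q => g.val q (X q) (Y q)) W := fun hW hX hY => by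
      rw [← one_add_one_zmod_two]
      exact g.isPureFunOn_val hW hX hY
    have hsmul : ∀ {c : M → SuperNumber} {X : ∀ q : M, SuperTangent m n q} {W : Set M},
        IsPureFunOn (m := m) (n := n) 0 c W → IsPureFieldOn 1 X W →
        IsPureFieldOn 1 (fun q => c q • X q) W := fun hc hX => by
      simpa using IsPureFieldOn.smul hc hX
    obtain ⟨V₁, hV₁U, hV₁, hpV₁, c, hc, hcinv⟩ :=
      (hfun hU (hy 0) (hy 1)).exists_inverse hU hp hpivot
    replace hy := fun i => (hy i).mono hV₁U
    have hpure : ∀ q ∈ V₁, ∀ i, IsPure 1 (y i q) := fun q hq i => (hy i).isPure q hq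
    -- Rescaling `y 1` by the inverse of `g(y 0, y 1)` makes `(y 0, f)` a hyperbolic pair.
    let f : ∀ q : M, SuperTangent m n q := fun q => c q • y 1 q
    have hf : IsPureFieldOn 1 f V₁ := hsmul hc (hy 1)
    have hf0 : ∀ q ∈ V₁, g.val q (f q) (y 0 q) = -1 := fun q hq => by
      rw [val_smul_left, g.val_comm_of_odd (hpure q hq 1) (hpure q hq 0), mul_neg, (hcinv q hq).2]
    have h0f : ∀ q ∈ V₁, g.val q (y 0 q) (f q) = 1 := fun q hq => by
      rw [g.val_comm_of_odd (hpure q hq 0) (hf.isPure q hq), hf0 q hq, neg_neg]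
    -- Symplectic projection: the coefficient of `y 0` is determined by pairing with `f` and that of
    -- `f` by pairing with `y 0`. The signs differ because `g(y 0, f) = 1` while `g(f, y 0) = -1`.
    let a : Fin k → M → SuperNumber := fun j q => -g.val q (y j.succ.succ q) (f q)
    let b : Fin k → M → SuperNumber := fun j q => g.val q (y j.succ.succ q) (y 0 q)
    have ha : ∀ j, IsPureFunOn (m := m) (n := n) 0 (a j) V₁ := fun j =>
      (hfun hV₁ (hy j.succ.succ) hf).neg
    have hb : ∀ j, IsPureFunOn (m := m) (n := n) 0 (b j) V₁ := fun j =>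
      hfun hV₁ (hy j.succ.succ) (hy 0)
    let z : Fin k → ∀ q : M, SuperTangent m n q :=
      fun j q => y j.succ.succ q + a j q • y 0 q + b j q • f q
    have hz : ∀ j, IsPureFieldOn 1 (z j) V₁ := fun j =>
      ((hy j.succ.succ).add (hsmul (ha j) (hy 0))).add (hsmul (hb j) hf)
    have horth0 : ∀ q ∈ V₁, ∀ j, g.val q (z j q) (y 0 q) = 0 := fun q hq j => by
      simp only [z, b]
      rw [val_add_left, val_add_left, val_smul_left, val_smul_left,
        g.val_self_of_odd (hpure q hq 0), hf0 q hq, mul_zero, add_zero, mul_neg, mul_one,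
        add_neg_cancel]
    have horthf : ∀ q ∈ V₁, ∀ j, g.val q (z j q) (f q) = 0 := fun q hq j => by
      simp only [z, a]
      rw [val_add_left, val_add_left, val_smul_left, val_smul_left,
        g.val_self_of_odd (hf.isPure q hq), h0f q hq, mul_zero, add_zero, mul_one,
        add_neg_cancel]
    -- The Schur complement is taken in the Gram matrix of `y`, so orthogonality to `y 1` is needed
    -- as well; accordingly the coefficient `b` of `f` appears below as `b c`, the coefficient of `y
    -- 1`.
    have horth1 : ∀ q ∈ V₁, ∀ j, g.val q (z j q) (y 1 q) = 0 := fun q hq j => by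
      have h1 : y 1 q = g.val q (y 0 q) (y 1 q) • f q := by
        simp only [f]
        rw [smul_smul, (hcinv q hq).1, one_smul]
      rw [h1]
      exact g.val_smul_right_eq_zero ((hz j).isPure q hq) (hf.isPure q hq) (horthf q hq j)
        ((hfun hV₁ (hy 0) (hy 1)).mem_part q hq)
    have hexp : ∀ j (v : SuperTangent m n p), body (g.val p (z j p) v)
        = body (g.val p (y j.succ.succ p) v) + body (a j p) * body (g.val p (y 0 p) v)
          + body (b j p) * body (c p) * body (g.val p (y 1 p) v) := fun j v => by
      simp only [z, f, val_add_left, val_smul_left, map_add, map_mul, mul_assoc]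
    have hgram : g.bodyGram p z = Matrix.of fun j l : Fin k =>
        g.bodyGram p y j.succ.succ l.succ.succ + body (a j p) * g.bodyGram p y 0 l.succ.succ
          + body (b j p) * body (c p) * g.bodyGram p y 1 l.succ.succ := by
      ext j l
      have h0 : g.val p (z j p) (a l p • y 0 p) = 0 :=
        g.val_smul_right_eq_zero ((hz j).isPure p hpV₁) (hpure p hpV₁ 0) (horth0 p hpV₁ j)
          ((ha l).mem_part p hpV₁)
      have h1 : g.val p (z j p) (b l p • f p) = 0 :=
        g.val_smul_right_eq_zero ((hz j).isPure p hpV₁) (hf.isPure p hpV₁) (horthf p hpV₁ j)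
          ((hb l).mem_part p hpV₁)
      have h2 : g.val p (z j p) (z l p) = g.val p (z j p) (y l.succ.succ p) := by
        change g.val p (z j p) (y l.succ.succ p + a l p • y 0 p + b l p • f p) = _
        rw [g.add_right, g.add_right, h0, h1, add_zero, add_zero]
      rw [bodyGram_apply, h2, hexp]
      rfl
    have hzdet : (g.bodyGram p z).det ≠ 0 := by
      rw [hgram]
      refine det_reduce_two_ne_zero hydet _ _ (fun j => ?_) fun j => ?_
      · simp only [bodyGram_apply]
        rw [← hexp, horth0 p hpV₁, map_zero]
      · simp only [bodyGram_apply]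
        rw [← hexp, horth1 p hpV₁, map_zero]
    obtain ⟨hk, V, hVV₁, hV, hpV, w, hw, hwq⟩ := exists_odd_symplectic k V₁ hV₁ hpV₁ z hz hzdet
    have hwmem : ∀ q ∈ V, ∀ i, w i q ∈ Submodule.span SuperNumber (Set.range fun i => z i q) :=
      fun q hq i => by
        rw [← (hwq q hq).1]
        exact Submodule.subset_span ⟨i, rfl⟩
    have hw0 : ∀ q ∈ V, ∀ i, g.val q (w i q) (y 0 q) = 0 := fun q hq i =>
      g.val_eq_zero_of_mem_span (by rintro _ ⟨j, rfl⟩; exact horth0 q (hVV₁ hq) j) (hwmem q hq i)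
    have hwf : ∀ q ∈ V, ∀ i, g.val q (w i q) (f q) = 0 := fun q hq i =>
      g.val_eq_zero_of_mem_span (by rintro _ ⟨j, rfl⟩; exact horthf q (hVV₁ hq) j) (hwmem q hq i)
    refine ⟨hk.add even_two, V, hVV₁.trans hV₁U, hV, hpV, Fin.cons (y 0) (Fin.cons f w), ?_,
      fun q hq => ⟨?_, ?_⟩⟩
    · exact Fin.cases ((hy 0).mono hVV₁) (Fin.cases (hf.mono hVV₁) hw)
    · rw [← hyspan q]
      rw [span_range_fin_succ, span_range_fin_succ (k := k), span_range_fin_succ,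
        span_range_fin_succ (k := k)]
      simp only [Fin.cons_zero, Fin.cons_succ]
      rw [(hwq q hq).1, Fin.succ_zero_eq_one]
      have hfy : Submodule.span SuperNumber {f q} = Submodule.span SuperNumber {y 1 q} :=
        Submodule.span_singleton_smul_eq ⟨⟨c q, _, (hcinv q (hVV₁ hq)).2,
          (hcinv q (hVV₁ hq)).1⟩, rfl⟩ (y 1 q)
      rw [hfy, ← sup_assoc, ← sup_assoc]
      refine span_sup_span_range_congr fun j => ?_
      simp only [z, add_assoc, add_sub_cancel_left]
      refine add_mem (Submodule.mem_sup_left (Submodule.smul_mem _ _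
        (Submodule.mem_span_singleton_self _))) (Submodule.mem_sup_right (Submodule.smul_mem _ _ ?_))
      rw [← hfy]
      exact Submodule.mem_span_singleton_self _
    · have hqV₁ := hVV₁ hq
      have hwp : ∀ i, IsPure 1 (w i q) := fun i => (hw i).isPure q hq
      refine Fin.cases ?_ (Fin.cases ?_ fun i => ?_)
      · refine Fin.cases ?_ (Fin.cases ?_ fun j => ?_) <;> simp only [Fin.cons_zero, Fin.cons_succ]
        · rw [blockJ_zero_zero, g.val_self_of_odd (hpure q hqV₁ 0)]
        · rw [Fin.succ_zero_eq_one, blockJ_zero_one, h0f q hqV₁]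
        · rw [blockJ_zero_succ_succ, g.val_eq_zero_comm (hwp j) (hpure q hqV₁ 0) (hw0 q hq j)]
      · refine Fin.cases ?_ (Fin.cases ?_ fun j => ?_) <;> simp only [Fin.cons_zero, Fin.cons_succ]
        · rw [Fin.succ_zero_eq_one, blockJ_one_zero, hf0 q hqV₁]
        · rw [Fin.succ_zero_eq_one, blockJ_one_one, g.val_self_of_odd (hf.isPure q hqV₁)]
        · rw [Fin.succ_zero_eq_one, blockJ_one_succ_succ,
            g.val_eq_zero_comm (hwp j) (hf.isPure q hqV₁) (hwf q hq j)]
      · refine Fin.cases ?_ (Fin.cases ?_ fun j => ?_) <;> simp only [Fin.cons_zero, Fin.cons_succ]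
        · rw [blockJ_succ_succ_zero, hw0 q hq]
        · rw [Fin.succ_zero_eq_one, blockJ_succ_succ_one, hwf q hq]
        · rw [blockJ_succ_succ, (hwq q hq).2]

/-! ## Existence of adapted frames -/

section CoordGram

variable [IsSuperManifold m n M] {e : OpenPartialHomeomorph M (SuperSpace m n)}

/-- The functional `X ↦ X(x^k)` is left linear, hence equal to `g(·, z k)` for some `z k` by
`perfect`. Expanding the `z k` in coordinate fields and taking bodies gives a right inverse of the
real Gram matrix. -/
theorem det_bodyGram_coordField (he : e ∈ atlas (SuperSpace m n) M) (hp : p ∈ e.source) :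
    (g.bodyGram p (coordField (m := m) (n := n) e)).det ≠ 0 := by
  have hdual : ∀ k, ∃ z : SuperTangent m n p, ∀ l,
      g.val p (coordField e l p) z = (Pi.single k 1 : _ → SuperNumber) l := by
    intro k
    obtain ⟨z, hz⟩ := g.perfect p
      ((LinearMap.proj (coordGerm he hp k)).comp (SuperTangent m n p).subtype)
    refine ⟨z, fun l => ?_⟩
    rw [hz, ← coordDeriv_coordGerm he hp, ← coe_coordField he hp]
    rfl
  choose z hz using hdual
  let C : Matrix (Fin m ⊕ Fin n) (Fin m ⊕ Fin n) ℝ :=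
    Matrix.of fun j k => body ((z k).1 (coordGerm he hp j))
  have hBC : g.bodyGram p (coordField (m := m) (n := n) e) * C = 1 := by
    ext l k
    have h := congrArg body (hz k l)
    rw [tangent_eq_sum he hp (z k), val_sum_right, map_sum] at h
    rw [Matrix.mul_apply]
    calc ∑ j, g.bodyGram p (coordField (m := m) (n := n) e) l j * C j k
        = ∑ j, body (g.val p (coordField e l p)
            ((z k).1 (coordGerm he hp j) • coordField e j p)) :=
          Finset.sum_congr rfl fun j _ => by
            rw [g.body_val_smul_right (isPure_coordField he hp l) (isPure_coordField he hp j),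
              mul_comm]
            rfl
      _ = _ := h
      _ = (1 : Matrix (Fin m ⊕ Fin n) (Fin m ⊕ Fin n) ℝ) l k := by
          rw [Matrix.one_apply, Pi.single_apply]
          split_ifs <;> simp
  intro h0
  have := congrArg Matrix.det hBC
  rw [Matrix.det_mul, h0, zero_mul, Matrix.det_one] at this
  exact zero_ne_one this

theorem det_bodyGram_coordField_parts (he : e ∈ atlas (SuperSpace m n) M) (hp : p ∈ e.source) :
    (g.bodyGram p fun i : Fin m => coordField (m := m) (n := n) e (Sum.inl i)).det ≠ 0 ∧
      (g.bodyGram p fun j : Fin n => coordField (m := m) (n := n) e (Sum.inr j)).det ≠ 0 := by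
  have h := g.det_bodyGram_coordField he hp
  have hB : g.bodyGram p (coordField (m := m) (n := n) e) = Matrix.fromBlocks
      (g.bodyGram p fun i : Fin m => coordField (m := m) (n := n) e (Sum.inl i)) 0 0
      (g.bodyGram p fun j : Fin n => coordField (m := m) (n := n) e (Sum.inr j)) := by
    ext (i | i) (j | j)
    · rfl
    · exact body_of_odd (by
        simpa [parity] using g.even p _ _ _ _ (isPure_coordField he hp (Sum.inl i))
          (isPure_coordField he hp (Sum.inr j)))
    · exact body_of_odd (by
        simpa [parity] using g.even p _ _ _ _ (isPure_coordField he hp (Sum.inr i))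
          (isPure_coordField he hp (Sum.inl j)))
    · rfl
  rw [hB, Matrix.det_fromBlocks_zero₂₁] at h
  exact mul_ne_zero_iff.1 h

end CoordGram

/-- Odd vector fields can be made orthogonal to even orthogonal ones without changing the body of
their Gram matrix. -/
theorem exists_odd_orthogonal_to_even {p : M} {V : Set M} (hV : IsOpen V) (hp : p ∈ V) {k l : ℕ}
    {w : Fin k → ∀ q : M, SuperTangent m n q} {d' : Fin k → M → SuperNumber}
    (hw : ∀ i, IsPureFieldOn 0 (w i) V)
    (hd' : ∀ i, IsPureFunOn (m := m) (n := n) 0 (d' i) V)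
    (horth : ∀ q ∈ V, ∀ i j, i ≠ j → g.val q (w i q) (w j q) = 0)
    (hinv : ∀ q ∈ V, ∀ i, d' i q * g.val q (w i q) (w i q) = 1)
    {y : Fin l → ∀ q : M, SuperTangent m n q} (hy : ∀ j, IsPureFieldOn 1 (y j) V) :
    ∃ z : Fin l → ∀ q : M, SuperTangent m n q, (∀ j, IsPureFieldOn 1 (z j) V) ∧
      g.bodyGram p z = g.bodyGram p y ∧ ∀ q ∈ V, ∀ j, (∀ i, g.val q (z j q) (w i q) = 0) ∧
        z j q - y j q ∈ Submodule.span SuperNumber (Set.range fun i => w i q) := by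
  -- The inverses `d'` allow projection onto the even fields. These coefficients are odd, hence
  -- without body.
  let a : Fin l → Fin k → M → SuperNumber := fun j i q => -(g.val q (y j q) (w i q) * d' i q)
  have ha : ∀ j i, IsPureFunOn (m := m) (n := n) 1 (a j i) V := fun j i => by
    simpa using ((g.isPureFunOn_val hV (hy j) (hw i)).mul (hd' i)).neg
  let z : Fin l → ∀ q : M, SuperTangent m n q := fun j q => y j q + ∑ i, a j i q • w i q
  have hz : ∀ j, IsPureFieldOn 1 (z j) V := fun j =>
    (hy j).add_sum Finset.univ fun i _ => by simpa using IsPureFieldOn.smul (ha j i) (hw i)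
  have hzw : ∀ q ∈ V, ∀ j i, g.val q (z j q) (w i q) = 0 := fun q hq j i => by
    simp only [z]
    rw [val_add_left, val_sum_left, Finset.sum_eq_single i]
    · rw [val_smul_left, neg_mul, mul_assoc, hinv q hq, mul_one, add_neg_cancel]
    · intro i' _ hi'
      rw [val_smul_left, horth q hq i' i hi', mul_zero]
    · simp
  refine ⟨z, hz, ?_, fun q hq j => ⟨hzw q hq j, ?_⟩⟩
  · ext j j'
    have h1 : g.val p (z j p) (z j' p) = g.val p (z j p) (y j' p) := by
      change g.val p (z j p) (y j' p + ∑ i, a j' i p • w i p) = _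
      rw [g.add_right, val_sum_right, Finset.sum_eq_zero, add_zero]
      intro i _
      exact g.val_smul_right_eq_zero ((hz j).isPure p hp) ((hw i).isPure p hp) (hzw p hp j i)
        ((ha j' i).mem_part p hp)
    have h2 : body (∑ i, g.val p (a j i p • w i p) (y j' p)) = 0 := by
      rw [map_sum]
      refine Finset.sum_eq_zero fun i _ => ?_
      rw [val_smul_left, map_mul, body_of_odd ((ha j i).mem_part p hp), zero_mul]
    rw [bodyGram_apply, h1]
    change body (g.val p (y j p + ∑ i, a j i p • w i p) (y j' p)) = _
    rw [val_add_left, val_sum_left, map_add, h2, add_zero]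
    rfl
  · simp only [z, add_sub_cancel_left]
    exact Submodule.sum_mem _ fun i _ => Submodule.smul_mem _ _ (Submodule.subset_span ⟨i, rfl⟩)

/-- Near every point there are a pure frame in which the metric has its normal form, and inverses of
the even diagonal entries. -/
theorem exists_frame [IsSuperManifold m n M] (p : M) :
    ∃ V : Set M, IsOpen V ∧ p ∈ V ∧ ∃ (w : Fin m → ∀ q : M, SuperTangent m n q)
      (v : Fin n → ∀ q : M, SuperTangent m n q) (d' : Fin m → M → SuperNumber),
      Even n ∧ (∀ i, IsPureFieldOn 0 (w i) V) ∧ (∀ j, IsPureFieldOn 1 (v j) V) ∧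
      (∀ i, IsPureFunOn (m := m) (n := n) 0 (d' i) V) ∧ ∀ q ∈ V,
        Submodule.span SuperNumber (Set.range fun k => Sum.elim w v k q) = ⊤ ∧
        (∀ i j, i ≠ j → g.val q (w i q) (w j q) = 0) ∧
        (∀ i, g.val q (w i q) (w i q) * d' i q = 1 ∧ d' i q * g.val q (w i q) (w i q) = 1) ∧
        (∀ i j, g.val q (v i q) (v j q) = blockJ n i j) ∧
        ∀ i j, g.val q (v i q) (w j q) = 0 := by
  let e := chartAt (SuperSpace m n) p
  have he : e ∈ atlas (SuperSpace m n) M := chart_mem_atlas _ p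
  have hp : p ∈ e.source := mem_chart_source _ p
  obtain ⟨hA, hD⟩ := g.det_bodyGram_coordField_parts he hp
  have hfield : ∀ k, IsPureFieldOn (m := m) (n := n) (parity k) (coordField e k) e.source :=
    fun k => ⟨isVectorFieldOn_coordField he k, fun q hq => isPure_coordField he hq k⟩
  -- The order matters: the orthogonal even fields are used to correct the odd ones, and the
  -- symplectic reduction then stays inside the span of the corrected odd fields, hence orthogonal
  -- to the even ones.
  obtain ⟨V₁, hV₁e, hV₁, hpV₁, w, d', hw, hd', hwq⟩ := g.exists_even_orthogonal m e.source
    e.open_source hp _ (fun i => hfield (Sum.inl i)) hA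
  obtain ⟨z, hz, hzgram, hzq⟩ := g.exists_odd_orthogonal_to_even hV₁ hpV₁ hw hd'
    (fun q hq => (hwq q hq).2.1) (fun q hq i => ((hwq q hq).2.2 i).2)
    (y := fun j => coordField e (Sum.inr j)) (fun j => (hfield (Sum.inr j)).mono hV₁e)
  obtain ⟨hn, V, hVV₁, hV, hpV, v, hv, hvq⟩ := g.exists_odd_symplectic n V₁ hV₁ hpV₁ z hz
    (by rwa [hzgram])
  refine ⟨V, hV, hpV, w, v, d', hn, fun i => (hw i).mono hVV₁, hv, fun i => (hd' i).mono hVV₁,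
    fun q hq => ⟨?_, (hwq q (hVV₁ hq)).2.1, (hwq q (hVV₁ hq)).2.2, (hvq q hq).2, fun i j => ?_⟩⟩
  · have hqV₁ := hVV₁ hq
    have hsum : ∀ (x : Fin m → SuperTangent m n q) (y : Fin n → SuperTangent m n q),
        Submodule.span SuperNumber (Set.range (Sum.elim x y))
          = Submodule.span SuperNumber (Set.range x) ⊔ Submodule.span SuperNumber (Set.range y) :=
      fun x y => by rw [Set.Sum.elim_range, Submodule.span_union]
    have h1 : (fun k => Sum.elim w v k q) = Sum.elim (fun i => w i q) fun j => v j q := by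
      funext k
      cases k <;> rfl
    have h2 : (fun k => coordField (m := m) (n := n) e k q)
        = Sum.elim (fun i => coordField e (Sum.inl i) q) fun j => coordField e (Sum.inr j) q := by
      funext k
      cases k <;> rfl
    rw [h1, hsum, (hvq q hq).1, span_sup_span_range_congr fun j => (hzq q hqV₁ j).2,
      (hwq q hqV₁).1, ← hsum, ← h2, span_coordField he (hV₁e hqV₁)]
  · refine g.val_eq_zero_of_mem_span (S := Set.range fun i => z i q) ?_ ?_
    · rintro _ ⟨i, rfl⟩
      exact (hzq q (hVV₁ hq) i).1 j
    · rw [← (hvq q hq).1]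
      exact Submodule.subset_span ⟨i, rfl⟩

end SuperRiemannianMetric

end Manifold

end

end SuperGeometry

/-! ### The normal form theorem. -/

theorem mainTheorem3 (m n : ℕ) (M : Type*) [TopologicalSpace M]
    [ChartedSpace (SuperGeometry.SuperSpace m n) M] [SuperGeometry.IsSuperManifold m n M]
    (g : SuperGeometry.SuperRiemannianMetric m n M) (p : M) :
    Even n ∧
    ∃ (U : Set M) (E : Fin m ⊕ Fin n → ∀ q : M, SuperGeometry.SuperTangent m n q)
      (d : Fin m → M → SuperGeometry.SuperNumber),
      IsOpen U ∧ p ∈ U ∧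
      (∀ k, SuperGeometry.IsVectorFieldOn (E k) U) ∧
      (∀ i, SuperGeometry.IsGInftyOn m n (d i) U) ∧
      ∀ q ∈ U,
        (∀ k, SuperGeometry.IsPure (SuperGeometry.parity k) (E k q)) ∧
        LinearIndependent SuperGeometry.SuperNumber (fun k => E k q) ∧
        Submodule.span SuperGeometry.SuperNumber (Set.range fun k => E k q) = ⊤ ∧
        (∀ i, d i q ∈ SuperGeometry.SuperNumber.part 0 ∧
          ∃ c ∈ SuperGeometry.SuperNumber.part 0, d i q * c = 1 ∧ c * d i q = 1) ∧
        Matrix.of (fun k l => g.val q (E k q) (E l q)) =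
          Matrix.fromBlocks (Matrix.diagonal fun i => d i q) 0 0
            (SuperGeometry.blockJ n) := by
  obtain ⟨V, hV, hpV, w, v, d', hn, hw, hv, hd', hvq⟩ := g.exists_frame p
  refine ⟨hn, V, Sum.elim w v, fun i q => g.val q (w i q) (w i q), hV, hpV, ?_, fun i =>
    (g.isPureFunOn_val hV (hw i) (hw i)).smooth, fun q hq => ?_⟩
  · rintro (i | j)
    · exact (hw i).isVectorFieldOn
    · exact (hv j).isVectorFieldOn
  obtain ⟨hspan, horth, hinv, hsymp, hvw⟩ := hvq q hq
  have hgram : Matrix.of (fun k l => g.val q (Sum.elim w v k q) (Sum.elim w v l q)) =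
      Matrix.fromBlocks (Matrix.diagonal fun i => g.val q (w i q) (w i q)) 0 0
        (SuperGeometry.blockJ n) := by
    refine Matrix.ext ?_
    rintro (i | i) (j | j)
    · simp only [Matrix.of_apply, Sum.elim_inl, Matrix.fromBlocks_apply₁₁, Matrix.diagonal_apply]
      split_ifs with h
      · rw [h]
      · exact horth i j h
    · exact g.val_eq_zero_comm ((hv j).isPure q hq) ((hw i).isPure q hq) (hvw j i)
    · exact hvw i j
    · exact hsymp i j
  refine ⟨?_, ?_, hspan, fun i =>
    ⟨(g.isPureFunOn_val hV (hw i) (hw i)).mem_part q hq, d' i q, (hd' i).mem_part q hq, hinv i⟩,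
    hgram⟩
  · rintro (i | j)
    · exact (hw i).isPure q hq
    · exact (hv j).isPure q hq
  · refine Fintype.linearIndependent_iff.2 fun c hc => ?_
    -- Pairing a linear relation with each frame vector in the right slot shows that its coefficient
    -- row is annihilated by the normal form. The invertible diagonal and the nondegenerate
    -- symplectic block then force it to vanish.
    have hpair : ∀ l, ∑ k, c k * Matrix.fromBlocks
        (Matrix.diagonal fun i => g.val q (w i q) (w i q)) 0 0 (SuperGeometry.blockJ n) k l = 0 := by
      intro l
      have h := congrArg (fun X => g.left q (Sum.elim w v l q) X) hc
      simp only [map_sum, map_smul, map_zero, smul_eq_mul] at h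
      rw [← hgram]
      exact h
    simp only [Fintype.sum_sum_type] at hpair
    rintro (i | j)
    · have h := hpair (Sum.inl i)
      simp only [Matrix.fromBlocks_apply₁₁, Matrix.fromBlocks_apply₂₁, Matrix.zero_apply, mul_zero,
        Finset.sum_const_zero, add_zero, Matrix.diagonal_apply, mul_ite, Finset.sum_ite_eq',
        Finset.mem_univ, if_true] at h
      rw [← mul_one (c _), ← (hinv i).1, ← mul_assoc, h, zero_mul]
    · have h : ∀ l, ∑ k, c (Sum.inr k) * SuperGeometry.blockJ n k l = 0 := fun l => by
        simpa using hpair (Sum.inr l)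
      exact congrFun (SuperGeometry.eq_zero_of_vecMul_blockJ hn h) j
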